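/- Let $X$ be a non-empty compact Hausdorff space, let $\sigma : X \to X$ be a homeomorphism, and put $\alpha(f) = f\circ\sigma^{-1}$ for $f \in C(X) = C(X,\mathbb{C})$. Let $$\ell^1(\Sigma) = \Big\{a : \mathbb{Z}\to C(X) : \|a\| = \sum_{n\in\mathbb{Z}} \|a(n)\|_\infty < \infty\Big\}$$ be the unital Banach $*$-algebra with multiplication $(ab)(n) = \sum_{k\in\mathbb{Z}} a(k)\,\alpha^k(b(n-k))$ and involution $a^*(n) = \overline{\alpha^n(a(-n))}$. Write $f\in C(X)$ also for the element of $\ell^1(\Sigma)$ that takes the value $f$ at $0$ and vanishes elsewhere, and let $\delta\in\ell^1(\Sigma)$ take the value $1$ at $1$ and vanish elsewhere. A representation of $\ell^1(\Sigma)$ on a complex vector space $E$ is a (not necessarily unital) algebra homomorphism $\pi$ from $\ell^1(\Sigma)$ into the linear operators on $E$. It is algebraically irreducible if $\pi(\ell^1(\Sigma))E \neq \{0\}$ and $\{0\}$ and $E$ are the only invariant linear subspaces of $E$. Two representations are algebraically equivalent if they are intertwined by a linear isomorphism. The primitive ideal corresponding to an algebraically irreducible representation is its kernel. Let $\mathrm{Per}(\sigma)$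 be the set of periodic points of $\sigma$, let $\mathrm{Per}(\sigma)/\mathbb{Z}$ be the set of their ($\mathbb{Z}$-)orbits, that is, of the finite orbits, and let $\mathbb{T}$ be the unit circle in $\mathbb{C}$. For $x\in \mathrm{Per}(\sigma)$ of period $p$ and $\lambda\in\mathbb{T}$, let $H_{x,\lambda}$ be a Hilbert space with orthonormal basis $e_0,\dots,e_{p-1}$, let $T_\lambda e_j = e_{j+1}$ for $0\le j<p-1$ and $T_\lambda e_{p-1} = \lambda e_0$, let $\rho_x(f)e_j = f(\sigma^j x)e_j$ for $f\in C(X)$ and $0\le j\le p-1$, and let $\pi_{x,\lambda}$ be the $*$-representation of $\ell^1(\Sigma)$ on $H_{x,\lambda}$ given by $$\pi_{x,\lambda}(a) = \sum_{n\in\mathbb{Z}} \rho_x(a(n))\,T_\lambda^n ,$$ so that $\pi_{x,\lambda}(f)=\rho_x(f)$ and $\pi_{x,\lambda}(\delta)=T_\lambda$. **Theorem (Finite dimensional representations).** 1. $\ell^1(\Sigma)$ has a finite dimensional algebraically irreducible representation if and only if $\mathrm{Per}(\sigma)\neq\emptyset$. 2. For $\mathfrak{o}\in\mathrm{Per}(\sigma)/\mathbb{Z}$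 and $\lambda\in\mathbb{T}$, choose $x\in\mathfrak{o}$ and let $\Xi_{\mathfrak{o},\lambda}$ be the algebraic equivalence class of $\pi_{x,\lambda}$. Then $\Xi_{\mathfrak{o},\lambda}$ does not depend on the choice of $x$, and $\Xi$ is a bijection from $(\mathrm{Per}(\sigma)/\mathbb{Z})\times\mathbb{T}$ onto the collection of algebraic equivalence classes of finite dimensional algebraically irreducible representations of $\ell^1(\Sigma)$. 3. The representation space of every finite dimensional algebraically irreducible representation $\pi$ of $\ell^1(\Sigma)$ can be supplied with an inner product that makes it a Hilbert space on which $\pi$ is a $*$-representation. In particular, the corresponding primitive ideal $\ker\pi$ is selfadjoint: $(\ker\pi)^* = \ker\pi$. -/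

import Mathlib

open scoped ENNReal

universe u v w

noncomputable section

namespace DynSys

/-! ### The Banach algebra of a topological dynamical system -/

section Algebra

variable {X : Type u} [TopologicalSpace X]

/-- The automorphism `α ^ n` of `C(X)`, that is, `f ↦ f ∘ σ ^ (-n)`. -/
def twist (σ : X ≃ₜ X) (n : ℤ) : C(X, ℂ) →⋆ₐ[ℂ] C(X, ℂ) :=
  ContinuousMap.compStarAlgHom' ℂ ℂ ⟨⇑(σ ^ (-n) : X ≃ₜ X), (σ ^ (-n) : X ≃ₜ X).continuous⟩

theorem twist_apply (σ : X ≃ₜ X) (n : ℤ) (f : C(X, ℂ)) (x : X) :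
    twist σ n f x = f ((σ ^ (-n) : X ≃ₜ X) x) := rfl

theorem twist_zero (σ : X ≃ₜ X) (f : C(X, ℂ)) : twist σ 0 f = f := by
  ext x; simp [twist_apply]

theorem twist_twist (σ : X ≃ₜ X) (m n : ℤ) (f : C(X, ℂ)) :
    twist σ m (twist σ n f) = twist σ (m + n) f := by
  ext x
  simp only [twist_apply]
  rw [neg_add_rev, zpow_add]
  rfl

variable [CompactSpace X]

theorem norm_twist_le (σ : X ≃ₜ X) (n : ℤ) (f : C(X, ℂ)) : ‖twist σ n f‖ ≤ ‖f‖ := by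
  rw [ContinuousMap.norm_le _ (norm_nonneg f)]
  intro x
  exact f.norm_coe_le_norm _

theorem norm_twist (σ : X ≃ₜ X) (n : ℤ) (f : C(X, ℂ)) : ‖twist σ n f‖ = ‖f‖ := by
  refine le_antisymm (norm_twist_le σ n f) ?_
  conv_lhs => rw [← twist_zero σ f, ← neg_add_cancel n, ← twist_twist]
  exact norm_twist_le _ _ _

/-- The space `ℓ¹(ℤ, C(X))` of absolutely summable families in `C(X)`; it is made into a Banach
`*`-algebra depending on the homeomorphism `σ` below. -/
def EllOne (_σ : X ≃ₜ X) : Type u := lp (fun _ : ℤ => C(X, ℂ)) 1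

variable {σ : X ≃ₜ X}

namespace EllOne

instance instNormedAddCommGroup : NormedAddCommGroup (EllOne σ) :=
  inferInstanceAs (NormedAddCommGroup (lp (fun _ : ℤ => C(X, ℂ)) 1))

instance instNormedSpace : NormedSpace ℂ (EllOne σ) :=
  inferInstanceAs (NormedSpace ℂ (lp (fun _ : ℤ => C(X, ℂ)) 1))

instance instCompleteSpace : CompleteSpace (EllOne σ) :=
  inferInstanceAs (CompleteSpace (lp (fun _ : ℤ => C(X, ℂ)) 1))

/-- The `n`-th coefficient `a(n)` of `a`. -/
def coeff (a : EllOne σ) (n : ℤ) : C(X, ℂ) :=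
  (show lp (fun _ : ℤ => C(X, ℂ)) 1 from a).1 n

@[ext]
theorem ext {a b : EllOne σ} (h : ∀ n, a.coeff n = b.coeff n) : a = b :=
  lp.ext (funext h)

theorem coeff_add (a b : EllOne σ) (n : ℤ) : (a + b).coeff n = a.coeff n + b.coeff n := rfl

theorem coeff_smul (c : ℂ) (a : EllOne σ) (n : ℤ) : (c • a).coeff n = c • a.coeff n := rfl

theorem coeff_zero (n : ℤ) : (0 : EllOne σ).coeff n = 0 := rfl

/-- The element of `ℓ¹(ℤ, C(X))` with given absolutely summable coefficients. -/
def mk (c : ℤ → C(X, ℂ)) (hc : Summable fun n => ‖c n‖) : EllOne σ :=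
  (⟨c, memℓp_gen (by simpa using hc)⟩ : lp (fun _ : ℤ => C(X, ℂ)) 1)

theorem coeff_mk (c : ℤ → C(X, ℂ)) (hc : Summable fun n => ‖c n‖) (n : ℤ) :
    (mk (σ := σ) c hc).coeff n = c n := rfl

theorem hasSum_norm (a : EllOne σ) : HasSum (fun n => ‖a.coeff n‖) ‖a‖ := by
  have h := lp.hasSum_norm (p := 1) (by simp) (show lp (fun _ : ℤ => C(X, ℂ)) 1 from a)
  simp only [ENNReal.toReal_one, Real.rpow_one] at h
  exact h

theorem norm_eq_tsum (a : EllOne σ) : ‖a‖ = ∑' n, ‖a.coeff n‖ := (hasSum_norm a).tsum_eq.symm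

/-- The monomial `f δⁿ`. -/
def single (n : ℤ) (f : C(X, ℂ)) : EllOne σ :=
  (lp.single 1 n f : lp (fun _ : ℤ => C(X, ℂ)) 1)

theorem coeff_single (n : ℤ) (f : C(X, ℂ)) (m : ℤ) :
    (single (σ := σ) n f).coeff m = if m = n then f else 0 := by
  by_cases h : m = n
  · subst h
    rw [if_pos rfl]
    exact lp.single_apply_self (E := fun _ : ℤ => C(X, ℂ)) 1 m f
  · rw [if_neg h]
    exact lp.single_apply_ne (E := fun _ : ℤ => C(X, ℂ)) 1 n f h

theorem hasSum_single (a : EllOne σ) : HasSum (fun n => single n (a.coeff n)) a :=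
  lp.hasSum_single (E := fun _ : ℤ => C(X, ℂ)) (p := 1) (by simp) a

theorem ext_single {B : Type*} [AddCommMonoid B] [TopologicalSpace B] [T2Space B]
    {f g : EllOne σ →+ B} (hf : Continuous f) (hg : Continuous g)
    (h : ∀ n c, f (single n c) = g (single n c)) (a : EllOne σ) : f a = g a := by
  have ha := hasSum_single a
  rw [← (ha.map f hf).tsum_eq, ← (ha.map g hg).tsum_eq]
  exact tsum_congr fun n => h n _

theorem summable_prod (a b : EllOne σ) :
    Summable fun q : ℤ × ℤ => ‖a.coeff q.2 * twist σ q.2 (b.coeff (q.1 - q.2))‖ := by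
  have h : Summable fun q : ℤ × ℤ => ‖a.coeff q.1‖ * ‖b.coeff q.2‖ :=
    (hasSum_norm a).summable.mul_of_nonneg (hasSum_norm b).summable
      (fun _ => norm_nonneg _) (fun _ => norm_nonneg _)
  let e : ℤ × ℤ ≃ ℤ × ℤ :=
    { toFun := fun q => (q.2, q.1 - q.2)
      invFun := fun q => (q.1 + q.2, q.1)
      left_inv := fun q => by simp
      right_inv := fun q => by simp }
  refine Summable.of_nonneg_of_le (fun _ => norm_nonneg _) (fun q => ?_) (e.summable_iff.2 h)
  refine (norm_mul_le _ _).trans ?_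
  rw [norm_twist]
  exact le_rfl

theorem summable_mul_coeff (a b : EllOne σ) (n : ℤ) :
    Summable fun k : ℤ => ‖a.coeff k * twist σ k (b.coeff (n - k))‖ :=
  (summable_prod a b).prod_factor n

theorem summable_norm_mul (a b : EllOne σ) :
    Summable fun n : ℤ => ‖∑' k : ℤ, a.coeff k * twist σ k (b.coeff (n - k))‖ :=
  Summable.of_nonneg_of_le (fun _ => norm_nonneg _)
    (fun n => norm_tsum_le_tsum_norm (summable_mul_coeff a b n)) (summable_prod a b).prod

/-- Twisted convolution: `(a * b)(n) = ∑ₖ a(k) · αᵏ(b(n - k))`. -/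
instance instMul : Mul (EllOne σ) :=
  ⟨fun a b => mk (fun n => ∑' k : ℤ, a.coeff k * twist σ k (b.coeff (n - k)))
    (summable_norm_mul a b)⟩

theorem coeff_mul (a b : EllOne σ) (n : ℤ) :
    (a * b).coeff n = ∑' k : ℤ, a.coeff k * twist σ k (b.coeff (n - k)) := rfl

/-- The unit `δ⁰`. -/
instance instOne : One (EllOne σ) := ⟨single 0 1⟩

theorem one_def : (1 : EllOne σ) = single 0 1 := rfl

/-- The involution: `a*(n)` is the complex conjugate of `αⁿ(a(-n))`. -/
instance instStar : Star (EllOne σ) :=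
  ⟨fun a => mk (fun n => star (twist σ n (a.coeff (-n)))) (by
    simp only [norm_star, norm_twist]
    exact (Equiv.neg ℤ).summable_iff (f := fun n => ‖a.coeff n‖) |>.2 (hasSum_norm a).summable)⟩

theorem coeff_star (a : EllOne σ) (n : ℤ) :
    (star a).coeff n = star (twist σ n (a.coeff (-n))) := rfl

protected theorem norm_mul_le (a b : EllOne σ) : ‖a * b‖ ≤ ‖a‖ * ‖b‖ := by
  have h0 := summable_prod a b
  have h2 : Summable fun q : ℤ × ℤ => ‖a.coeff q.1 * twist σ q.1 (b.coeff (q.2 - q.1))‖ := h0.prod_symm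
  have h3 (k : ℤ) : HasSum (fun n => ‖a.coeff k‖ * ‖b.coeff (n - k)‖) (‖a.coeff k‖ * ‖b‖) :=
    ((Equiv.subRight k).hasSum_iff (f := fun n => ‖b.coeff n‖) |>.2 (hasSum_norm b)).mul_left _
  calc ‖a * b‖ = ∑' n, ‖(a * b).coeff n‖ := norm_eq_tsum _
    _ ≤ ∑' n, ∑' k, ‖a.coeff k * twist σ k (b.coeff (n - k))‖ :=
        Summable.tsum_le_tsum (fun n => norm_tsum_le_tsum_norm (summable_mul_coeff a b n))
          (summable_norm_mul a b) h0.prod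
    _ = ∑' k, ∑' n, ‖a.coeff k * twist σ k (b.coeff (n - k))‖ :=
        Summable.tsum_comm (f := fun k n => ‖a.coeff k * twist σ k (b.coeff (n - k))‖) h2
    _ ≤ ∑' k, ‖a.coeff k‖ * ‖b‖ := by
        refine Summable.tsum_le_tsum (fun k => ?_) h2.prod ((hasSum_norm a).summable.mul_right _)
        refine (Summable.tsum_le_tsum (fun n => ?_) (h2.prod_factor k) (h3 k).summable).trans
          (h3 k).tsum_eq.le
        refine (norm_mul_le _ _).trans ?_
        rw [norm_twist]
    _ = ‖a‖ * ‖b‖ := ((hasSum_norm a).mul_right _).tsum_eq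

protected theorem add_mul' (a b c : EllOne σ) : (a + b) * c = a * c + b * c := by
  ext1 n
  simp only [coeff_mul, coeff_add, add_mul]
  exact (summable_mul_coeff a c n).of_norm.tsum_add (summable_mul_coeff b c n).of_norm

protected theorem mul_add' (a b c : EllOne σ) : a * (b + c) = a * b + a * c := by
  ext1 n
  simp only [coeff_mul, coeff_add, map_add, mul_add]
  exact (summable_mul_coeff a b n).of_norm.tsum_add (summable_mul_coeff a c n).of_norm

protected theorem smul_mul' (r : ℂ) (a b : EllOne σ) : (r • a) * b = r • (a * b) := by
  ext1 n
  simp only [coeff_mul, coeff_smul, smul_mul_assoc]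
  exact tsum_const_smul'' r

protected theorem mul_smul' (r : ℂ) (a b : EllOne σ) : a * (r • b) = r • (a * b) := by
  ext1 n
  simp only [coeff_mul, coeff_smul, map_smul, mul_smul_comm]
  exact tsum_const_smul'' r

/-- Multiplication as a bounded bilinear map. -/
def mulCLM : EllOne σ →L[ℂ] EllOne σ →L[ℂ] EllOne σ :=
  LinearMap.mkContinuous₂
    (LinearMap.mk₂ ℂ (fun a b => a * b) EllOne.add_mul' EllOne.smul_mul' EllOne.mul_add'
      EllOne.mul_smul') 1 (fun a b => by simpa using EllOne.norm_mul_le a b)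

theorem mulCLM_apply (a b : EllOne σ) : mulCLM a b = a * b := rfl

theorem continuous_mul_left (a : EllOne σ) : Continuous fun b => a * b := (mulCLM a).continuous

theorem continuous_mul_right (b : EllOne σ) : Continuous fun a => a * b :=
  (mulCLM.flip b).continuous

/-- Left multiplication as an additive map. -/
def mulL (a : EllOne σ) : EllOne σ →+ EllOne σ := AddMonoidHom.mk' (fun b => a * b)
  (EllOne.mul_add' a)

/-- Right multiplication as an additive map. -/
def mulR (b : EllOne σ) : EllOne σ →+ EllOne σ := AddMonoidHom.mk' (fun a => a * b)
  (fun x y => EllOne.add_mul' x y b)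

theorem single_mul_single (i j : ℤ) (f g : C(X, ℂ)) :
    (single i f * single j g : EllOne σ) = single (i + j) (f * twist σ i g) := by
  ext1 n
  rw [coeff_mul, tsum_eq_single i]
  · simp only [coeff_single, if_true]
    by_cases h : n = i + j
    · subst h; simp
    · rw [if_neg h, if_neg (by omega)]; simp
  · intro k hk
    simp [coeff_single, hk]

protected theorem mul_assoc' (a b c : EllOne σ) : a * b * c = a * (b * c) := by
  refine ext_single (f := (mulR c).comp (mulR b)) (g := mulR (b * c))
    ((continuous_mul_right c).comp (continuous_mul_right b)) (continuous_mul_right _)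
    (fun i f => ?_) a
  change single i f * b * c = single i f * (b * c)
  refine ext_single (f := (mulR c).comp (mulL (single i f)))
    (g := (mulL (single i f)).comp (mulR c))
    ((continuous_mul_right c).comp (continuous_mul_left _))
    ((continuous_mul_left _).comp (continuous_mul_right _)) (fun j g => ?_) b
  change single i f * single j g * c = single i f * (single j g * c)
  refine ext_single (f := mulL (single i f * single j g))
    (g := (mulL (single i f)).comp (mulL (single j g)))
    (continuous_mul_left _)
    ((continuous_mul_left _).comp (continuous_mul_left _)) (fun k h => ?_) c
  change single i f * single j g * single k h = single i f * (single j g * single k h)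
  simp only [single_mul_single, map_mul, twist_twist, mul_assoc, add_assoc]

protected theorem one_mul' (a : EllOne σ) : 1 * a = a := by
  refine ext_single (f := mulL 1) (g := AddMonoidHom.id _) (continuous_mul_left _)
    continuous_id (fun i f => ?_) a
  change single 0 1 * single i f = single i f
  simp [single_mul_single, twist_zero]

protected theorem mul_one' (a : EllOne σ) : a * 1 = a := by
  refine ext_single (f := mulR 1) (g := AddMonoidHom.id _) (continuous_mul_right _)
    continuous_id (fun i f => ?_) a
  change single i f * single 0 1 = single i f
  simp [single_mul_single]

instance instRing : Ring (EllOne σ) :=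
  { (inferInstance : AddCommGroup (EllOne σ)) with
    mul := (· * ·)
    one := 1
    left_distrib := EllOne.mul_add'
    right_distrib := EllOne.add_mul'
    zero_mul := fun a => (mulR a).map_zero
    mul_zero := fun a => (mulL a).map_zero
    mul_assoc := EllOne.mul_assoc'
    one_mul := EllOne.one_mul'
    mul_one := EllOne.mul_one' }

instance instNormedRing : NormedRing (EllOne σ) :=
  { instNormedAddCommGroup, instRing with
    norm_mul_le := EllOne.norm_mul_le }

instance instAlgebra : Algebra ℂ (EllOne σ) :=
  Algebra.ofModule EllOne.smul_mul' (fun r a b => EllOne.mul_smul' r a b)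

instance instNormedAlgebra : NormedAlgebra ℂ (EllOne σ) :=
  { instAlgebra with
    norm_smul_le := fun r a => (norm_smul r a).le }

protected theorem norm_star' (a : EllOne σ) : ‖star a‖ = ‖a‖ := by
  rw [norm_eq_tsum, norm_eq_tsum]
  simp only [coeff_star, norm_star, norm_twist]
  exact (Equiv.neg ℤ).tsum_eq fun n => ‖a.coeff n‖

protected theorem star_star' (a : EllOne σ) : star (star a) = a := by
  ext1 n
  simp [coeff_star, ← map_star, twist_twist, twist_zero]

protected theorem star_add' (a b : EllOne σ) : star (a + b) = star a + star b := by
  ext1 n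
  simp [coeff_star, coeff_add]

/-- The involution as an additive map. -/
def starHom : EllOne σ →+ EllOne σ := AddMonoidHom.mk' star EllOne.star_add'

theorem continuous_starHom : Continuous (starHom (σ := σ)) :=
  AddMonoidHomClass.continuous_of_bound starHom 1 fun a => by
    rw [one_mul]; exact (EllOne.norm_star' a).le

theorem star_single (i : ℤ) (f : C(X, ℂ)) :
    star (single i f : EllOne σ) = single (-i) (twist σ (-i) (star f)) := by
  ext1 n
  simp only [coeff_star, coeff_single]
  by_cases h : n = -i
  · subst h; simp [map_star]
  · rw [if_neg h, if_neg (by omega)]; simp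

protected theorem star_mul' (a b : EllOne σ) : star (a * b) = star b * star a := by
  have hc := continuous_starHom (σ := σ)
  refine ext_single (f := starHom.comp (mulR b)) (g := (mulL (star b)).comp starHom)
    (hc.comp (continuous_mul_right b)) ((continuous_mul_left _).comp hc) (fun i f => ?_) a
  change star (single i f * b) = star b * star (single i f)
  refine ext_single (f := starHom.comp (mulL (single i f)))
    (g := (mulR (star (single i f))).comp starHom)
    (hc.comp (continuous_mul_left _)) ((continuous_mul_right _).comp hc) (fun j g => ?_) b
  change star (single i f * single j g) = star (single j g) * star (single i f)
  simp only [single_mul_single, star_single, star_mul, map_mul, ← map_star, twist_twist]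
  rw [neg_add_rev, neg_add_cancel_right]

instance instStarRing : StarRing (EllOne σ) where
  star_involutive := EllOne.star_star'
  star_mul := EllOne.star_mul'
  star_add := EllOne.star_add'

instance instStarModule : StarModule ℂ (EllOne σ) where
  star_smul r a := by
    ext1 n
    simp [coeff_star, coeff_smul]

instance instNormedStarGroup : NormedStarGroup (EllOne σ) where
  norm_star_le a := (EllOne.norm_star' a).le

/-- The element `δ`. -/
def delta (σ : X ≃ₜ X) : EllOne σ := single 1 1

end EllOne

end Algebra

/-! ### `*`-representations from covariant pairs -/

section Covariant

variable {X : Type u} [TopologicalSpace X] [CompactSpace X] {σ : X ≃ₜ X}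
variable {B : Type v} [CStarAlgebra B]

/-- A covariant pair in a unital `C*`-algebra `B`: a unital `*`-homomorphism `ρ` of `C(X)` and a
unitary `U` with `ρ (α f) = U ρ(f) U⁻¹`. -/
structure CovariantPair (σ : X ≃ₜ X) (B : Type v) [CStarAlgebra B] where
  ρ : C(X, ℂ) →⋆ₐ[ℂ] B
  U : unitary B
  cov : ∀ f, ρ (twist σ 1 f) = (U : B) * ρ f * ((U⁻¹ : unitary B) : B)

namespace CovariantPair

theorem norm_map_le (P : CovariantPair σ B) (f : C(X, ℂ)) : ‖P.ρ f‖ ≤ ‖f‖ :=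
  NonUnitalStarAlgHom.norm_apply_le (P.ρ : C(X, ℂ) →⋆ₙₐ[ℂ] B) f

theorem norm_unitary_le (U : unitary B) (b : B) : ‖b * (U : B)‖ ≤ ‖b‖ :=
  (CStarRing.norm_mul_coe_unitary b U).le

theorem cov_mul (P : CovariantPair σ B) (f : C(X, ℂ)) :
    P.ρ (twist σ 1 f) * (P.U : B) = (P.U : B) * P.ρ f := by
  rw [P.cov, mul_assoc, ← Submonoid.coe_mul, inv_mul_cancel]
  simp

theorem cov_zpow (P : CovariantPair σ B) (n : ℤ) (f : C(X, ℂ)) :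
    P.ρ (twist σ n f) * ((P.U ^ n : unitary B) : B) = ((P.U ^ n : unitary B) : B) * P.ρ f := by
  induction n generalizing f with
  | zero => simp [twist_zero]
  | succ n ih =>
    rw [add_comm, zpow_add, zpow_one, ← twist_twist, Submonoid.coe_mul, ← mul_assoc, P.cov_mul,
      mul_assoc, ih, mul_assoc]
  | pred n ih =>
    have key : (P.U : B) * (P.ρ (twist σ (-(n : ℤ) - 1) f) *
        ((P.U ^ (-(n : ℤ) - 1) : unitary B) : B)) =
        (P.U : B) * (((P.U ^ (-(n : ℤ) - 1) : unitary B) : B) * P.ρ f) := by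
      rw [← mul_assoc, ← P.cov_mul, twist_twist, mul_assoc, ← mul_assoc (P.U : B),
        ← Submonoid.coe_mul, ← zpow_one_add, add_sub_cancel, ih]
    have h2 := congrArg (fun b => ((P.U⁻¹ : unitary B) : B) * b) key
    simpa only [← mul_assoc, ← Submonoid.coe_mul, inv_mul_cancel, Submonoid.coe_one, one_mul]
      using h2

theorem norm_term_le (P : CovariantPair σ B) (a : EllOne σ) (n : ℤ) :
    ‖P.ρ (a.coeff n) * ((P.U ^ n : unitary B) : B)‖ ≤ ‖a.coeff n‖ :=
  (norm_unitary_le _ _).trans (P.norm_map_le _)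

theorem summable_norm_term (P : CovariantPair σ B) (a : EllOne σ) :
    Summable fun n : ℤ => ‖P.ρ (a.coeff n) * ((P.U ^ n : unitary B) : B)‖ :=
  Summable.of_nonneg_of_le (fun _ => norm_nonneg _) (P.norm_term_le a)
    (EllOne.hasSum_norm a).summable

/-- The sum `∑ₙ ρ(a(n)) Uⁿ`. -/
def intFun (P : CovariantPair σ B) (a : EllOne σ) : B :=
  ∑' n : ℤ, P.ρ (a.coeff n) * ((P.U ^ n : unitary B) : B)

theorem intFun_add (P : CovariantPair σ B) (a b : EllOne σ) :
    P.intFun (a + b) = P.intFun a + P.intFun b := by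
  simp only [intFun, EllOne.coeff_add, map_add, add_mul]
  exact (P.summable_norm_term a).of_norm.tsum_add (P.summable_norm_term b).of_norm

/-- `intFun` as an additive map. -/
def intHom (P : CovariantPair σ B) : EllOne σ →+ B := AddMonoidHom.mk' P.intFun P.intFun_add

theorem continuous_intHom (P : CovariantPair σ B) : Continuous P.intHom :=
  AddMonoidHomClass.continuous_of_bound P.intHom 1 fun a => by
    rw [one_mul, EllOne.norm_eq_tsum]
    exact (norm_tsum_le_tsum_norm (P.summable_norm_term a)).trans
      (Summable.tsum_le_tsum (P.norm_term_le a) (P.summable_norm_term a)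
        (EllOne.hasSum_norm a).summable)

theorem intFun_single (P : CovariantPair σ B) (n : ℤ) (f : C(X, ℂ)) :
    P.intFun (EllOne.single n f) = P.ρ f * ((P.U ^ n : unitary B) : B) := by
  rw [intFun, tsum_eq_single n]
  · simp [EllOne.coeff_single]
  · intro m hm
    simp [EllOne.coeff_single, hm]

theorem intFun_mul (P : CovariantPair σ B) (a b : EllOne σ) :
    P.intFun (a * b) = P.intFun a * P.intFun b := by
  have hc := P.continuous_intHom
  refine EllOne.ext_single (f := P.intHom.comp (EllOne.mulR b))
    (g := (AddMonoidHom.mulRight (P.intFun b)).comp P.intHom)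
    (hc.comp (EllOne.continuous_mul_right b)) ((continuous_mul_const _).comp hc)
    (fun i f => ?_) a
  change P.intFun (EllOne.single i f * b) = P.intFun (EllOne.single i f) * P.intFun b
  refine EllOne.ext_single (f := P.intHom.comp (EllOne.mulL (EllOne.single i f)))
    (g := (AddMonoidHom.mulLeft (P.intFun (EllOne.single i f))).comp P.intHom)
    (hc.comp (EllOne.continuous_mul_left _)) ((continuous_const_mul _).comp hc)
    (fun j g => ?_) b
  change P.intFun (EllOne.single i f * EllOne.single j g) =
    P.intFun (EllOne.single i f) * P.intFun (EllOne.single j g)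
  rw [EllOne.single_mul_single, intFun_single, intFun_single, intFun_single, map_mul, zpow_add,
    Submonoid.coe_mul, mul_assoc, ← mul_assoc (P.ρ (twist σ i g)), P.cov_zpow]
  simp only [mul_assoc]

theorem intFun_star (P : CovariantPair σ B) (a : EllOne σ) :
    P.intFun (star a) = star (P.intFun a) := by
  have hc := P.continuous_intHom
  refine EllOne.ext_single (f := P.intHom.comp EllOne.starHom)
    (g := (starAddEquiv : B ≃+ B).toAddMonoidHom.comp P.intHom)
    (hc.comp EllOne.continuous_starHom) (continuous_star.comp hc) (fun i f => ?_) a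
  change P.intFun (star (EllOne.single i f)) = star (P.intFun (EllOne.single i f))
  rw [EllOne.star_single, intFun_single, intFun_single, P.cov_zpow, star_mul, map_star,
    zpow_neg, ← Unitary.star_eq_inv, Unitary.coe_star]

/-- The unital `*`-homomorphism `∑ₙ fₙ δⁿ ↦ ∑ₙ ρ(fₙ) Uⁿ` on `ℓ¹(Σ)` given by a covariant pair. -/
def toStarAlgHom (P : CovariantPair σ B) : EllOne σ →⋆ₐ[ℂ] B where
  toFun := P.intFun
  map_one' := by rw [EllOne.one_def, intFun_single]; simp
  map_mul' := P.intFun_mul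
  map_zero' := P.intHom.map_zero
  map_add' := P.intFun_add
  commutes' r := by
    have h : algebraMap ℂ (EllOne σ) r = EllOne.single 0 (algebraMap ℂ C(X, ℂ) r) := by
      rw [Algebra.algebraMap_eq_smul_one, Algebra.algebraMap_eq_smul_one, EllOne.one_def]
      ext1 n
      rw [EllOne.coeff_smul, EllOne.coeff_single, EllOne.coeff_single]
      split_ifs <;> simp
    rw [h, intFun_single, AlgHomClass.commutes]
    simp
  map_star' := P.intFun_star

theorem toStarAlgHom_apply (P : CovariantPair σ B) (a : EllOne σ) :
    P.toStarAlgHom a = ∑' n : ℤ, P.ρ (a.coeff n) * ((P.U ^ n : unitary B) : B) := rfl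

theorem toStarAlgHom_single_zero (P : CovariantPair σ B) (f : C(X, ℂ)) :
    P.toStarAlgHom (EllOne.single 0 f) = P.ρ f := by
  rw [toStarAlgHom_apply]
  exact (P.intFun_single 0 f).trans (by simp)

theorem toStarAlgHom_delta (P : CovariantPair σ B) :
    P.toStarAlgHom (EllOne.delta σ) = (P.U : B) := by
  rw [toStarAlgHom_apply]
  exact (P.intFun_single 1 1).trans (by simp)

end CovariantPair

end Covariant

/-! ### The representations associated with periodic points -/

section PointRep

variable {X : Type u} [TopologicalSpace X] [CompactSpace X]

/-- The index set `{0, …, p - 1}` of an orthonormal basis, in an arbitrary universe. -/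
abbrev Idx (p : ℕ) : Type w := ULift.{w} (Fin p)

/-- The matrix `T_λ`: it maps `e_j` to `e_{j+1}` for `j < p - 1`, and `e_{p-1}` to `λ e_0`. -/
def shiftMatrix (p : ℕ) (lam : Circle) : Matrix (Idx.{w} p) (Idx.{w} p) ℂ :=
  Matrix.of fun i j =>
    if (j.down : ℕ) + 1 = p then (if (i.down : ℕ) = 0 then (lam : ℂ) else 0)
    else if (i.down : ℕ) = (j.down : ℕ) + 1 then 1 else 0

theorem shiftMatrix_mem_unitary (p : ℕ) (lam : Circle) :
    shiftMatrix.{w} p lam ∈ unitary (Matrix (Idx.{w} p) (Idx.{w} p) ℂ) := by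
  have hl : (starRingEnd ℂ) (lam : ℂ) * lam = 1 := by
    rw [← Circle.coe_inv_eq_conj, ← Circle.coe_mul]; simp
  refine Matrix.mem_unitaryGroup_iff'.2 ?_
  ext i k
  rw [Matrix.mul_apply, Matrix.one_apply, Matrix.star_eq_conjTranspose]
  obtain ⟨⟨i, hi⟩⟩ := i
  obtain ⟨⟨k, hk⟩⟩ := k
  simp only [Matrix.conjTranspose_apply, shiftMatrix, Matrix.of_apply]
  by_cases h : i + 1 = p
  · rw [Finset.sum_eq_single (⟨⟨0, by omega⟩⟩ : Idx.{w} p)]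
    · by_cases h' : k + 1 = p
      · obtain rfl : i = k := by omega
        simp [h, hl]
      · have : i ≠ k := by omega
        simp [h, h', this]
    · rintro ⟨⟨j, hj⟩⟩ - hne
      have : j ≠ 0 := by rintro rfl; exact hne rfl
      simp [h, this]
    · simp
  · rw [Finset.sum_eq_single (⟨⟨i + 1, by omega⟩⟩ : Idx.{w} p)]
    · by_cases h' : k + 1 = p
      · have : i ≠ k := by omega
        simp [h, h', this]
      · simp [h, h']
    · rintro ⟨⟨j, hj⟩⟩ - hne
      have : j ≠ i + 1 := by rintro rfl; exact hne rfl
      simp [h, this]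
    · simp

/-- The matrix `T_λ` as an element of the unitary group. -/
def shiftUnitary (p : ℕ) (lam : Circle) : unitary (Matrix (Idx.{w} p) (Idx.{w} p) ℂ) :=
  ⟨shiftMatrix.{w} p lam, shiftMatrix_mem_unitary p lam⟩

/-- The homomorphism sending `f` to the diagonal matrix with entries
`f x, f (σ x), …, f (σ ^ (p - 1) x)`. -/
def diagHom (σ : X ≃ₜ X) (x : X) (p : ℕ) :
    C(X, ℂ) →⋆ₐ[ℂ] Matrix (Idx.{w} p) (Idx.{w} p) ℂ where
  toFun f := Matrix.diagonal fun i => f ((⇑σ)^[(i.down : ℕ)] x)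
  map_one' := Matrix.diagonal_one
  map_mul' _ _ := (Matrix.diagonal_mul_diagonal _ _).symm
  map_zero' := Matrix.diagonal_zero
  map_add' _ _ := (Matrix.diagonal_add _ _).symm
  commutes' _ := rfl
  map_star' _ := (Matrix.diagonal_conjTranspose _).symm

theorem diagHom_apply (σ : X ≃ₜ X) (x : X) (p : ℕ) (f : C(X, ℂ)) :
    diagHom.{u, w} σ x p f = Matrix.diagonal fun i => f ((⇑σ)^[(i.down : ℕ)] x) := rfl

theorem diagHom_cov (σ : X ≃ₜ X) (x : X) (p : ℕ) (hp : (⇑σ)^[p] x = x) (lam : Circle)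
    (f : C(X, ℂ)) :
    diagHom.{u, w} σ x p (twist σ 1 f) * shiftMatrix p lam =
      shiftMatrix p lam * diagHom.{u, w} σ x p f := by
  have hs (y : X) : (σ ^ (-1 : ℤ) : X ≃ₜ X) (σ y) = y := by
    rw [zpow_neg_one]; exact σ.symm_apply_apply y
  ext i j
  rw [diagHom_apply, diagHom_apply, Matrix.diagonal_mul, Matrix.mul_diagonal]
  obtain ⟨⟨i, hi⟩⟩ := i
  obtain ⟨⟨j, hj⟩⟩ := j
  simp only [shiftMatrix, Matrix.of_apply, twist_apply]
  by_cases h : j + 1 = p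
  · by_cases h' : i = 0
    · have hx : (σ ^ (-1 : ℤ) : X ≃ₜ X) x = (⇑σ)^[j] x := by
        conv_lhs => rw [← hp, ← h, Function.iterate_succ_apply', hs]
      subst h'
      rw [if_pos h, if_pos rfl, Function.iterate_zero_apply, hx, mul_comm]
    · simp [h, h']
  · by_cases h' : i = j + 1
    · subst h'
      rw [Function.iterate_succ_apply', hs]
      simp [h]
    · simp [h, h']

/-- The Hilbert space with orthonormal basis `e_0, …, e_{p-1}`, where `p` is the period of `x`. -/
abbrev PointSpace (σ : X ≃ₜ X) (x : X) : Type w :=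
  EuclideanSpace ℂ (Idx.{w} (Function.minimalPeriod σ x))

/-- The covariant pair `(ρ_x, T_λ)` on the Hilbert space attached to `x`. -/
def pointPair (σ : X ≃ₜ X) (x : X) (lam : Circle) :
    CovariantPair σ (PointSpace.{u, w} σ x →L[ℂ] PointSpace.{u, w} σ x) where
  ρ := (Matrix.toEuclideanCLM (n := Idx.{w} (Function.minimalPeriod σ x)) (𝕜 := ℂ) :
      _ →⋆ₐ[ℂ] _).comp (diagHom.{u, w} σ x (Function.minimalPeriod σ x))
  U := ⟨Matrix.toEuclideanCLM (n := Idx.{w} (Function.minimalPeriod σ x)) (𝕜 := ℂ)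
      (shiftMatrix.{w} (Function.minimalPeriod σ x) lam),
    Unitary.map_mem _ (shiftMatrix_mem_unitary.{w} _ lam)⟩
  cov f := by
    have h := congrArg (Matrix.toEuclideanCLM (n := Idx.{w} (Function.minimalPeriod σ x)) (𝕜 := ℂ))
      (diagHom_cov.{u, w} σ x _ (Function.iterate_minimalPeriod) lam f)
    rw [map_mul, map_mul] at h
    refine Eq.trans ?_ (congrArg (fun b => b * _) h)
    rw [mul_assoc]
    refine (mul_one _).symm.trans (congrArg (fun b => _ * b) ?_)
    exact (congrArg Subtype.val (mul_inv_cancel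
      (⟨_, Unitary.map_mem _ (shiftMatrix_mem_unitary.{w} _ lam)⟩ : unitary
        (PointSpace.{u, w} σ x →L[ℂ] PointSpace.{u, w} σ x)))).symm

/-- The `*`-representation `π_{x,λ}` of `ℓ¹(Σ)` on the Hilbert space attached to `x`, sending
`∑ₙ fₙ δⁿ` to `∑ₙ ρ_x(fₙ) T_λⁿ`. It is only used for periodic points `x`. -/
def pointStarRep (σ : X ≃ₜ X) (x : X) (lam : Circle) :
    EllOne σ →⋆ₐ[ℂ] (PointSpace.{u, w} σ x →L[ℂ] PointSpace.{u, w} σ x) :=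
  (pointPair.{u, w} σ x lam).toStarAlgHom

end PointRep

/-! ### Representations on finite dimensional vector spaces -/

section Rep

variable (A : Type v) [Ring A] [Algebra ℂ A]

/-- A representation of `A` on a finite dimensional complex vector space: a (not necessarily
unital) algebra homomorphism into the linear operators. -/
structure FDRep : Type (max v (w + 1)) where
  /-- the representation space -/
  E : Type w
  [addCommGroup : AddCommGroup E]
  [module : Module ℂ E]
  [finiteDimensional : FiniteDimensional ℂ E]
  /-- the homomorphism -/
  π : A →ₙₐ[ℂ] Module.End ℂ E

attribute [instance] FDRep.addCommGroup FDRep.module FDRep.finiteDimensional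

namespace FDRep

variable {A}

/-- Algebraic irreducibility: `π(A)E ≠ 0`, and the only invariant subspaces are `0` and `E`. -/
def IsAlgIrreducible (R : FDRep.{v, w} A) : Prop :=
  (∃ a e, R.π a e ≠ 0) ∧
    ∀ W : Submodule ℂ R.E, (∀ a, ∀ e ∈ W, R.π a e ∈ W) → W = ⊥ ∨ W = ⊤

/-- Algebraic equivalence: there is a linear isomorphism intertwining the representations. -/
def AlgEquivalent (R S : FDRep.{v, w} A) : Prop :=
  ∃ T : R.E ≃ₗ[ℂ] S.E, ∀ a e, T (R.π a e) = S.π a (T e)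

/-- Algebraic equivalence as an equivalence relation. -/
def setoid (A : Type v) [Ring A] [Algebra ℂ A] : Setoid (FDRep.{v, w} A) where
  r := AlgEquivalent
  iseqv :=
    { refl := fun R => ⟨LinearEquiv.refl ℂ R.E, fun _ _ => rfl⟩
      symm := fun {R S} ⟨T, hT⟩ => ⟨T.symm, fun a e => by
        rw [LinearEquiv.symm_apply_eq, hT, LinearEquiv.apply_symm_apply]⟩
      trans := fun {R S Q} ⟨T, hT⟩ ⟨T', hT'⟩ => ⟨T.trans T', fun a e => by
        rw [LinearEquiv.trans_apply, LinearEquiv.trans_apply, hT, hT']⟩ }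

/-- Algebraic equivalence classes of finite dimensional representations. -/
def EquivClass (A : Type v) [Ring A] [Algebra ℂ A] : Type (max v (w + 1)) :=
  Quotient (setoid.{v, w} A)

/-- The algebraic equivalence class of a representation. -/
def toClass (R : FDRep.{v, w} A) : EquivClass.{v, w} A := Quotient.mk (setoid A) R

/-- Algebraic equivalence classes of finite dimensional algebraically irreducible
representations. -/
def IrrClass (A : Type v) [Ring A] [Algebra ℂ A] : Type (max v (w + 1)) :=
  {c : EquivClass.{v, w} A // ∃ R : FDRep.{v, w} A, R.IsAlgIrreducible ∧ R.toClass = c}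

/-- The representation space can be given an inner product for which it is a Hilbert space and
`⟪π(a) e, e'⟫ = ⟪e, π(a*) e'⟫` for all `a`, `e` and `e'`, so that `π` is a `*`-representation. -/
def IsUnitarizable [Star A] (R : FDRep.{v, w} A) : Prop :=
  ∃ c : InnerProductSpace.Core ℂ R.E,
    (letI : NormedAddCommGroup R.E := c.toNormedAddCommGroup
     CompleteSpace R.E) ∧
    ∀ (a : A) (e e' : R.E), c.inner (R.π a e) e' = c.inner e (R.π (star a) e')

/-- The kernel of a representation, as a two-sided ideal. For an algebraically irreducible
representation this is the corresponding primitive ideal. -/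
def kerIdeal (R : FDRep.{v, w} A) : TwoSidedIdeal A := TwoSidedIdeal.ker R.π

end FDRep

/-- A two-sided ideal `I` is selfadjoint if `I* = I`. -/
def IsSelfadjointIdeal {A : Type v} [Ring A] [Star A] (I : TwoSidedIdeal A) : Prop :=
  star '' (I : Set A) = (I : Set A)

end Rep

/-! ### Periodic points and finite orbits -/

section Orbits

variable {X : Type u} [TopologicalSpace X]

/-- The set `Per(σ)` of periodic points, as a type. -/
abbrev Per (σ : X ≃ₜ X) : Type u := {x : X // x ∈ Function.periodicPts σ}

/-- Lying in the same orbit of the action of `ℤ`, as an equivalence relation on `Per(σ)`. -/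
def orbitSetoid (σ : X ≃ₜ X) : Setoid (Per σ) where
  r x y := ∃ n : ℤ, (σ ^ n : X ≃ₜ X) x.1 = y.1
  iseqv :=
    { refl := fun _ => ⟨0, by simp⟩
      symm := fun {x y} ⟨n, hn⟩ => ⟨-n, by
        rw [← hn, zpow_neg]; exact (σ ^ n : X ≃ₜ X).symm_apply_apply x.1⟩
      trans := fun {x y z} ⟨n, hn⟩ ⟨m, hm⟩ => ⟨m + n, by
        rw [← hm, ← hn, zpow_add]; rfl⟩ }

/-- The space `Per(σ)/ℤ` of finite orbits. -/
def FiniteOrbits (σ : X ≃ₜ X) : Type u := Quotient (orbitSetoid σ)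

/-- The orbit of a periodic point. -/
def orbit {σ : X ≃ₜ X} (x : Per σ) : FiniteOrbits σ := Quotient.mk (orbitSetoid σ) x

/-- The representation `π_{x,λ}` for a periodic point `x` and `λ` in the unit circle, on the
underlying vector space of its Hilbert space. -/
def pointRep [CompactSpace X] {σ : X ≃ₜ X} (x : Per σ) (lam : Circle) :
    FDRep.{u, w} (EllOne σ) where
  E := PointSpace.{u, w} σ x.1
  π :=
    { toFun := fun a => (pointStarRep.{u, w} σ x.1 lam a : PointSpace.{u, w} σ x.1 →ₗ[ℂ] _)
      map_smul' := fun r a => by rw [map_smul]; rfl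
      map_zero' := by rw [map_zero]; rfl
      map_add' := fun a b => by rw [map_add]; rfl
      map_mul' := fun a b => by rw [map_mul]; rfl }

end Orbits

end DynSys

end

/-! Let `R` be irreducible on a finite dimensional space. The operators of `C(X)` commute, so they
share an eigenvector `e`; its eigenvalues form a character of `C(X)`, that is, evaluation at a point
`x`. By covariance `δⁿ e` has weight `σⁿ x`, and vectors of distinct weights are independent, so
finite dimension forces `x` to be periodic, say of period `p`. Then `δᵖ` preserves the weight space
of `x` and has an eigenvector `v` there, with eigenvalue `λ`. Since `δᵖ` and its inverse have norm
at most one, `|λ| = 1` (`exists_isWeightVector`).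

The map `e_j ↦ δʲ v` from the space of `π_{x,λ}` intertwines the actions of all monomials `f δⁿ`.
These span a dense subspace only, and no continuity of `R` is assumed. It is automatic: annihilators
of nonzero vectors are maximal left ideals, hence closed, and the quotients are finite dimensional
(`continuous_apply`). So the map intertwines the two representations, and Schur's lemma makes it an
isomorphism (`IsWeightVector.algEquivalent`).

Conversely each `π_{x,λ}` is irreducible, because functions separate the points of the orbit and `δ`
permutes the basis lines transitively. The weights recover the orbit and the scalar `δᵖ` recovers
`λ` (`orbit_eq_and_eq_of_algEquivalent`). Unitarity is transported from the model. -/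

noncomputable section

namespace DynSys

namespace FDRep

/-! ### Irreducible representations of a complex algebra -/

section General

variable {A : Type v} [Ring A] [Algebra ℂ A]

/-- The operator of `1` is an idempotent with invariant kernel. If the kernel is zero, idempotence
gives the identity; if it is everything, then `π(a) = π(a)π(1) = 0` for all `a`. -/
theorem IsAlgIrreducible.map_one {R : FDRep.{v, w} A} (hR : R.IsAlgIrreducible) (e : R.E) :
    R.π 1 e = e := by
  have hcomm (a : A) (e : R.E) : R.π 1 (R.π a e) = R.π a e := by
    rw [← Module.End.mul_apply, ← map_mul, one_mul]
  have hcomm' (a : A) (e : R.E) : R.π a (R.π 1 e) = R.π a e := by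
    rw [← Module.End.mul_apply, ← map_mul, mul_one]
  rcases hR.2 (LinearMap.ker (R.π 1)) (fun a e he => by
    rw [LinearMap.mem_ker] at he ⊢
    rw [hcomm, ← hcomm', he, map_zero]) with h | h
  · refine LinearMap.ker_eq_bot.1 h ?_
    rw [hcomm']
  · obtain ⟨a, e, hae⟩ := hR.1
    have he : R.π 1 e = 0 := LinearMap.mem_ker.1 (h ▸ Submodule.mem_top)
    exact absurd (by rw [← hcomm', he, _root_.map_zero]) hae

theorem IsAlgIrreducible.exists_map_eq {R : FDRep.{v, w} A} (hR : R.IsAlgIrreducible) {e : R.E}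
    (he : e ≠ 0) (e' : R.E) : ∃ a, R.π a e = e' := by
  let F : A →ₗ[ℂ] R.E :=
    { toFun := fun a => R.π a e
      map_add' := fun a b => by rw [map_add]; rfl
      map_smul' := fun c a => by rw [map_smul]; rfl }
  have hF : LinearMap.range F = ⊤ := by
    refine (hR.2 (LinearMap.range F) ?_).resolve_left ?_
    · rintro a _ ⟨b, rfl⟩
      exact ⟨a * b, by change R.π (a * b) e = _; rw [map_mul]; rfl⟩
    · intro h
      have h1 : F 1 ∈ LinearMap.range F := ⟨1, rfl⟩
      rw [h, Submodule.mem_bot] at h1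
      exact he ((hR.map_one e).symm.trans h1)
  exact LinearMap.range_eq_top.1 hF e'

/-- The annihilator of a vector, as a left ideal. -/
def annihilator (R : FDRep.{v, w} A) (e : R.E) : Ideal A where
  carrier := {a | R.π a e = 0}
  add_mem' {a b} ha hb := by
    change R.π (a + b) e = 0
    rw [map_add, LinearMap.add_apply, show R.π a e = 0 from ha, show R.π b e = 0 from hb, add_zero]
  zero_mem' := by
    change R.π 0 e = 0
    rw [map_zero, LinearMap.zero_apply]
  smul_mem' a b hb := by
    change R.π (a * b) e = 0
    rw [map_mul, Module.End.mul_apply, show R.π b e = 0 from hb, map_zero]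

theorem mem_annihilator {R : FDRep.{v, w} A} {e : R.E} {a : A} :
    a ∈ R.annihilator e ↔ R.π a e = 0 := Iff.rfl

/-- If `a` does not kill `e`, some `b` satisfies `π(ba)e = e`. Then `1 - ba` kills `e`, so a larger
left ideal containing `a` contains `1`. Maximality is what later yields closedness. -/
theorem IsAlgIrreducible.annihilator_isMaximal {R : FDRep.{v, w} A} (hR : R.IsAlgIrreducible)
    {e : R.E} (he : e ≠ 0) : (R.annihilator e).IsMaximal := by
  rw [Ideal.isMaximal_iff]
  refine ⟨fun h => he ((hR.map_one e).symm.trans h), fun J a hJ ha haJ => ?_⟩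
  obtain ⟨b, hb⟩ := hR.exists_map_eq (e := R.π a e) ha e
  have h1 : 1 - b * a ∈ J := hJ (by
    rw [mem_annihilator, map_sub, LinearMap.sub_apply, hR.map_one, map_mul, Module.End.mul_apply,
      hb, sub_self])
  simpa using J.add_mem h1 (J.mul_mem_left b haJ)

/-- Schur's lemma: the kernel and the range are invariant subspaces. -/
theorem IsAlgIrreducible.bijective_of_intertwining {R S : FDRep.{v, w} A}
    (hR : R.IsAlgIrreducible) (hS : S.IsAlgIrreducible) (T : R.E →ₗ[ℂ] S.E)
    (hT : ∀ a e, T (R.π a e) = S.π a (T e)) {e : R.E} (he : T e ≠ 0) : Function.Bijective T := by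
  constructor
  · refine LinearMap.ker_eq_bot.1 ((hR.2 (LinearMap.ker T) fun a e he => ?_).resolve_right ?_)
    · rw [LinearMap.mem_ker] at he ⊢
      rw [hT, he, map_zero]
    · intro h
      exact he (LinearMap.mem_ker.1 (h ▸ Submodule.mem_top))
  · refine LinearMap.range_eq_top.1 ((hS.2 (LinearMap.range T) ?_).resolve_left ?_)
    · rintro a _ ⟨e, rfl⟩
      exact ⟨R.π a e, hT a e⟩
    · intro h
      have h1 : T e ∈ LinearMap.range T := ⟨e, rfl⟩
      rw [h, Submodule.mem_bot] at h1
      exact he h1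

/-- Take a nonzero invariant subspace of minimal dimension. Inside it, an eigenspace of one operator
is again invariant by commutativity, so by minimality it is the whole subspace; every operator is
thus scalar there. -/
theorem exists_common_eigenvector {B E : Type*}
    [AddCommGroup E] [Module ℂ E] [FiniteDimensional ℂ E] [Nontrivial E]
    (ρ : B → Module.End ℂ E) (hρ : ∀ f g, Commute (ρ f) (ρ g)) :
    ∃ e : E, e ≠ 0 ∧ ∀ f, ∃ c : ℂ, ρ f e = c • e := by
  let P : ℕ → Prop := fun n => ∃ W : Submodule ℂ E, W ≠ ⊥ ∧ (∀ f, ∀ e ∈ W, ρ f e ∈ W) ∧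
    Module.finrank ℂ W = n
  have hP : ∃ n, P n := ⟨_, ⊤, top_ne_bot, fun _ _ _ => Submodule.mem_top, rfl⟩
  classical
  obtain ⟨W, hW0, hW, hn⟩ := Nat.find_spec hP
  obtain ⟨e, heW, he⟩ := (Submodule.ne_bot_iff W).1 hW0
  refine ⟨e, he, fun f => ?_⟩
  have : Nontrivial W := Submodule.nontrivial_iff_ne_bot.2 hW0
  obtain ⟨c, hc⟩ := Module.End.exists_eigenvalue ((ρ f).restrict (hW f))
  obtain ⟨v, hv⟩ := hc.exists_hasEigenvector
  let V : Submodule ℂ E := W ⊓ LinearMap.ker (ρ f - c • 1)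
  have hVmem (x : E) : x ∈ V ↔ x ∈ W ∧ ρ f x = c • x := by
    simp [V, sub_eq_zero]
  have hvV : (v : E) ∈ V := by
    rw [hVmem]
    exact ⟨v.2, congrArg Subtype.val hv.apply_eq_smul⟩
  have hV0 : V ≠ ⊥ := fun h => hv.2 (Subtype.ext (by
    rw [h, Submodule.mem_bot] at hvV; exact hvV))
  have hle : Module.finrank ℂ W ≤ Module.finrank ℂ V := by
    rw [hn]
    refine Nat.find_min' hP ⟨V, hV0, fun g x hx => ?_, rfl⟩
    rw [hVmem] at hx ⊢
    refine ⟨hW g x hx.1, ?_⟩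
    rw [← Module.End.mul_apply, (hρ f g).eq, Module.End.mul_apply, hx.2, map_smul]
  have hVW : V = W := Submodule.eq_of_le_of_finrank_le inf_le_left hle
  exact ⟨c, ((hVmem e).1 (hVW ▸ heW)).2⟩

end General

/-! ### Automatic continuity and eigenvalue bounds in Banach algebras -/

section Normed

variable {A : Type v} [NormedRing A] [NormedAlgebra ℂ A] [CompleteSpace A]

/-- For `e ≠ 0` the annihilator of `e` is a maximal left ideal, hence closed. The function factors
through the quotient by it, a finite dimensional Hausdorff space on which every functional is
continuous. -/
theorem IsAlgIrreducible.continuous_apply {R : FDRep.{v, w} A} (hR : R.IsAlgIrreducible)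
    (φ : R.E →ₗ[ℂ] ℂ) (e : R.E) : Continuous fun a => φ (R.π a e) := by
  by_cases he : e = 0
  · simpa [he] using continuous_const
  let F : A →ₗ[ℂ] R.E :=
    { toFun := fun a => R.π a e
      map_add' := fun a b => by rw [map_add]; rfl
      map_smul' := fun c a => by rw [map_smul]; rfl }
  have := hR.annihilator_isMaximal he
  have hcl : IsClosed (LinearMap.ker F : Set A) :=
    Ideal.IsMaximal.isClosed (I := R.annihilator e)
  have hfin : FiniteDimensional ℂ (A ⧸ LinearMap.ker F) :=
    Module.Finite.equiv (LinearMap.quotKerEquivRange F).symm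
  let Q : (A ⧸ LinearMap.ker F) →ₗ[ℂ] ℂ :=
    φ ∘ₗ (LinearMap.range F).subtype ∘ₗ (LinearMap.quotKerEquivRange F).toLinearMap
  have : IsClosed ((LinearMap.ker F).toAddSubgroup : Set A) := hcl
  have hT2 : T2Space (A ⧸ LinearMap.ker F) := by
    have : T3Space (A ⧸ LinearMap.ker F) := Submodule.t3_quotient_of_isClosed _
    infer_instance
  have hQ : Continuous Q := LinearMap.continuous_of_finiteDimensional Q
  exact hQ.comp (continuous_quotient_mk' (s := (LinearMap.ker F).quotientRel))

/-- Otherwise `c - a` is invertible, while its operator kills `e`. The factor `‖1‖` appears because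
the norm of the unit is not normalised. -/
theorem IsAlgIrreducible.norm_eigenvalue_le {R : FDRep.{v, w} A} (hR : R.IsAlgIrreducible)
    {a : A} {c : ℂ} {e : R.E} (he : e ≠ 0) (h : R.π a e = c • e) : ‖c‖ ≤ ‖a‖ * ‖(1 : A)‖ := by
  by_contra! hlt
  have hu : IsUnit (algebraMap ℂ A c - a) := spectrum.mem_resolventSet_of_norm_lt_mul hlt
  obtain ⟨b, hb⟩ := hu.exists_left_inv
  apply he
  have h0 : R.π (algebraMap ℂ A c - a) e = 0 := by
    rw [Algebra.algebraMap_eq_smul_one, map_sub, map_smul, LinearMap.sub_apply,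
      LinearMap.smul_apply, hR.map_one, h, sub_self]
  rw [← hR.map_one e, ← hb, map_mul, Module.End.mul_apply, h0, map_zero]

end Normed

end FDRep

/-! ### Finite orbits and separation of points by continuous functions -/

section Points

variable {X : Type u} [TopologicalSpace X]

theorem zpow_natCast_apply (σ : X ≃ₜ X) (n : ℕ) (x : X) :
    (σ ^ (n : ℤ) : X ≃ₜ X) x = (⇑σ)^[n] x := by
  rw [zpow_natCast]
  induction n with
  | zero => rfl
  | succ n ih => rw [pow_succ', Function.iterate_succ_apply', ← ih]; rfl

theorem exists_iterate_eq_zpow {σ : X ≃ₜ X} {x : X} (hx : x ∈ Function.periodicPts σ) (n : ℤ) :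
    ∃ k : ℕ, (⇑σ)^[k] x = (σ ^ n : X ≃ₜ X) x := by
  have hp := Function.minimalPeriod_pos_of_mem_periodicPts hx
  set p := Function.minimalPeriod σ x with hpdef
  have hfix (m : ℕ) : (σ ^ ((p * m : ℕ) : ℤ) : X ≃ₜ X) x = x := by
    rw [zpow_natCast_apply]
    exact (Function.isPeriodicPt_minimalPeriod (⇑σ) x).mul_const m
  -- Adding the multiple `p * |n|` of the period does not move the image of `x`, and makes the
  -- exponent nonnegative because `p ≥ 1`.
  refine ⟨(n + (p * n.natAbs : ℕ)).toNat, ?_⟩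
  rw [← zpow_natCast_apply, Int.toNat_of_nonneg, zpow_add]
  · exact congrArg _ (hfix _)
  · push_cast
    have : |n| ≤ p * |n| := le_mul_of_one_le_left (abs_nonneg n) (by exact_mod_cast hp)
    linarith [neg_abs_le n]

variable [CompactSpace X] [T2Space X]

theorem exists_eq_one_of_notMem {y : X} {s : Set X} (hs : s.Finite) (hy : y ∉ s) :
    ∃ f : C(X, ℂ), f y = 1 ∧ ∀ z ∈ s, f z = 0 := by
  obtain ⟨f, hf0, hf1, -⟩ := exists_continuous_zero_one_of_isClosed hs.isClosed
    (isClosed_singleton (x := y)) (Set.disjoint_singleton_right.2 hy)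
  refine ⟨(⟨fun r : ℝ => (r : ℂ), Complex.continuous_ofReal⟩ : C(ℝ, ℂ)).comp f, ?_, fun z hz => ?_⟩
  · simpa using hf1 rfl
  · simpa using hf0 hz

theorem eq_of_forall_apply_eq {x y : X} (h : ∀ f : C(X, ℂ), f x = f y) : x = y := by
  by_contra hne
  obtain ⟨f, hf, hf'⟩ := exists_eq_one_of_notMem (Set.finite_singleton y) (y := x) hne
  have := h f
  rw [hf, hf' y rfl] at this
  exact one_ne_zero this

/-- A function that is `1` at one weight and `0` at the finitely many others isolates one term of a
vanishing linear combination. -/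
theorem linearIndependent_of_apply_eq {ι E : Type*} [AddCommGroup E] [Module ℂ E]
    (ρ : C(X, ℂ) → Module.End ℂ E) {y : ι → X} (hy : Function.Injective y) {v : ι → E}
    (hv : ∀ i, v i ≠ 0) (h : ∀ f i, ρ f (v i) = f (y i) • v i) : LinearIndependent ℂ v := by
  classical
  rw [linearIndependent_iff']
  intro s g hg i hi
  obtain ⟨f, hf1, hf0⟩ := exists_eq_one_of_notMem (y := y i)
    (s := y '' (s.erase i : Finset ι)) (Set.toFinite _) (by
      rintro ⟨j, hj, hji⟩
      exact (Finset.mem_erase.1 hj).1 (hy hji))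
  have h1 := congrArg (ρ f) hg
  rw [map_sum, map_zero, Finset.sum_eq_single i] at h1
  · rw [map_smul, h, hf1, one_smul] at h1
    exact (smul_eq_zero.1 h1).resolve_right (hv i)
  · intro j hj hji
    rw [map_smul, h, hf0 _ ⟨j, Finset.mem_coe.2 (Finset.mem_erase.2 ⟨hji, hj⟩), rfl⟩, zero_smul,
      smul_zero]
  · exact fun h => absurd hi h

theorem exists_eq_eval (χ : C(X, ℂ) →ₐ[ℂ] ℂ) : ∃ x, ∀ f, χ f = f x := by
  obtain ⟨x, hx⟩ := (WeakDual.CharacterSpace.continuousMapEval_bijective (X := X) (𝕜 := ℂ)).2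
    (WeakDual.CharacterSpace.equivAlgHom.symm χ)
  refine ⟨x, fun f => ?_⟩
  have := DFunLike.congr_fun hx f
  rw [WeakDual.CharacterSpace.continuousMapEval_apply_apply] at this
  exact this.symm

end Points

/-! ### Weight vectors in irreducible representations -/

section Weight

variable {X : Type u} [TopologicalSpace X] [CompactSpace X] {σ : X ≃ₜ X}

open EllOne

theorem EllOne.norm_single (n : ℤ) (f : C(X, ℂ)) : ‖(single n f : EllOne σ)‖ = ‖f‖ := by
  rw [norm_eq_tsum, tsum_eq_single n]
  · rw [coeff_single, if_pos rfl]
  · intro m hm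
    rw [coeff_single, if_neg hm, norm_zero]

theorem EllOne.norm_single_one_le (n : ℤ) : ‖(single n 1 : EllOne σ)‖ ≤ 1 := by
  rw [EllOne.norm_single, ContinuousMap.norm_le _ zero_le_one]
  simp

theorem EllOne.single_eq_mul (n : ℤ) (f : C(X, ℂ)) :
    (single n f : EllOne σ) = single 0 f * single n 1 := by
  rw [single_mul_single, map_one, mul_one, zero_add]

theorem EllOne.single_eq_mul' (n : ℤ) (f : C(X, ℂ)) :
    (single n f : EllOne σ) = single n 1 * single 0 (twist σ (-n) f) := by
  rw [single_mul_single, one_mul, twist_twist, add_neg_cancel, twist_zero, add_zero]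

theorem EllOne.single_one_mul_single_one (m n : ℤ) :
    (single m 1 * single n 1 : EllOne σ) = single (m + n) 1 := by
  rw [single_mul_single, map_one, mul_one]

theorem EllOne.single_add (n : ℤ) (f g : C(X, ℂ)) :
    (single n (f + g) : EllOne σ) = single n f + single n g := by
  ext1 m
  rw [coeff_add, coeff_single, coeff_single, coeff_single]
  split_ifs <;> simp

theorem EllOne.single_smul (n : ℤ) (c : ℂ) (f : C(X, ℂ)) :
    (single n (c • f) : EllOne σ) = c • single n f := by
  ext1 m
  rw [coeff_smul, coeff_single, coeff_single]
  split_ifs <;> simp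

namespace FDRep

/-- A common eigenvector of `C(X)` for the evaluation at `x` that is also an eigenvector of `δᵖ`
with eigenvalue `lam`, where `p` is the period of `x`. -/
structure IsWeightVector (R : FDRep.{u, w} (EllOne σ)) (x : X) (lam : ℂ) (e : R.E) : Prop where
  ne_zero : e ≠ 0
  apply_fun : ∀ f, R.π (single 0 f) e = f x • e
  apply_shift : R.π (single (Function.minimalPeriod σ x : ℤ) 1) e = lam • e

variable {R : FDRep.{u, w} (EllOne σ)}

theorem single_one_apply (m n : ℤ) (e : R.E) :
    R.π (single m 1) (R.π (single n 1) e) = R.π (single (m + n) 1) e := by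
  rw [← Module.End.mul_apply, ← map_mul, single_one_mul_single_one]

theorem IsAlgIrreducible.single_neg_apply (hR : R.IsAlgIrreducible) (n : ℤ) (e : R.E) :
    R.π (single (-n) 1) (R.π (single n 1) e) = e := by
  rw [single_one_apply, neg_add_cancel]
  exact hR.map_one e

theorem IsAlgIrreducible.single_one_apply_ne_zero (hR : R.IsAlgIrreducible) (n : ℤ) {e : R.E}
    (he : e ≠ 0) : R.π (single n 1) e ≠ 0 := fun h => he (by
  rw [← hR.single_neg_apply n e, h, map_zero])

/-- Covariance, in the form `f δⁿ = δⁿ α⁻ⁿ(f)`, moves the weight along the orbit. -/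
theorem apply_fun_single_one {x : X} {e : R.E} (h : ∀ f, R.π (single 0 f) e = f x • e) (n : ℤ)
    (f : C(X, ℂ)) :
    R.π (single 0 f) (R.π (single n 1) e) = f ((σ ^ n : X ≃ₜ X) x) • R.π (single n 1) e := by
  rw [← Module.End.mul_apply, ← map_mul, ← single_eq_mul, single_eq_mul', map_mul,
    Module.End.mul_apply, h, map_smul, twist_apply, neg_neg]

variable [T2Space X]

/-- An infinite forward orbit would make the vectors `δⁿ e` an infinite independent family. -/
theorem IsAlgIrreducible.mem_periodicPts (hR : R.IsAlgIrreducible) {x : X} {e : R.E} (he : e ≠ 0)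
    (h : ∀ f, R.π (single 0 f) e = f x • e) : x ∈ Function.periodicPts σ := by
  by_contra hx
  have hinj : Function.Injective fun n : ℕ => (⇑σ)^[n] x := by
    intro m n hmn
    wlog hle : m ≤ n generalizing m n
    · exact (this hmn.symm (le_of_not_ge hle)).symm
    by_contra hne
    refine hx (Function.mk_mem_periodicPts (n := n - m) (by omega) ?_)
    refine (σ.injective.iterate m) ?_
    rw [← Function.iterate_add_apply, Nat.add_sub_cancel' hle]
    exact hmn.symm
  have hli : LinearIndependent ℂ fun n : ℕ => R.π (single (n : ℤ) 1) e :=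
    linearIndependent_of_apply_eq (fun f => R.π (single 0 f)) hinj
      (fun n => hR.single_one_apply_ne_zero n he) (fun f n => by
        rw [apply_fun_single_one h, zpow_natCast_apply])
  have := hli.finite
  exact not_finite ℕ

theorem IsAlgIrreducible.exists_isWeightVector (hR : R.IsAlgIrreducible) :
    ∃ (x : Per σ) (lam : Circle) (e : R.E), R.IsWeightVector x.1 lam e := by
  obtain ⟨a₀, e₀, h₀⟩ := hR.1
  have : Nontrivial R.E := ⟨_, _, h₀⟩
  obtain ⟨e, he, hc⟩ := exists_common_eigenvector (fun f : C(X, ℂ) => R.π (single 0 f))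
    (fun f g => by
      rw [commute_iff_eq, ← map_mul, ← map_mul, single_mul_single, single_mul_single, twist_zero,
        twist_zero, mul_comm])
  choose c hc using hc
  have hinj {a b : ℂ} (h : a • e = b • e) : a = b := smul_left_injective ℂ he h
  -- Since `e ≠ 0`, the eigenvalue of `f` at `e` is unique, so it depends linearly and
  -- multiplicatively on `f`.
  let χ : C(X, ℂ) →ₐ[ℂ] ℂ := AlgHom.ofLinearMap
    { toFun := c
      map_add' := fun f g => hinj (by
        rw [← hc, single_add, map_add, LinearMap.add_apply, hc, hc, add_smul])
      map_smul' := fun r f => hinj (by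
        rw [← hc, single_smul, map_smul, LinearMap.smul_apply, hc, RingHom.id_apply, smul_eq_mul,
          mul_smul]) }
    (hinj (by rw [one_smul]; exact (hc 1).symm.trans (hR.map_one e)))
    (fun f g => hinj (by
      change c (f * g) • e = (c f * c g) • e
      have hfg : (single 0 (f * g) : EllOne σ) = single 0 f * single 0 g := by
        rw [single_mul_single, twist_zero, add_zero]
      rw [← hc, hfg, map_mul, Module.End.mul_apply, hc, map_smul, hc, smul_smul, mul_comm]))
  obtain ⟨x, hx⟩ := exists_eq_eval χ
  have hxe (f : C(X, ℂ)) : R.π (single 0 f) e = f x • e := (hc f).trans (by rw [← hx f]; rfl)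
  have hper := hR.mem_periodicPts he hxe
  set p := Function.minimalPeriod σ x with hp
  -- The vector `e` need not be an eigenvector of `δᵖ`. The full weight space `W` of `x` is
  -- invariant under `δᵖ` because `σᵖ x = x`, so an eigenvector is chosen there instead.
  let W : Submodule ℂ R.E := ⨅ f : C(X, ℂ), LinearMap.ker (R.π (single 0 f) - f x • 1)
  have hW (v : R.E) : v ∈ W ↔ ∀ f, R.π (single 0 f) v = f x • v := by
    simp [W, sub_eq_zero]
  have hWp : ∀ v ∈ W, R.π (single (p : ℤ) 1) v ∈ W := fun v hv => by
    rw [hW] at hv ⊢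
    intro f
    rw [apply_fun_single_one hv, zpow_natCast_apply, hp, Function.iterate_minimalPeriod]
  have : Nontrivial W :=
    Submodule.nontrivial_iff_ne_bot.2 ((Submodule.ne_bot_iff W).2 ⟨e, (hW e).2 hxe, he⟩)
  obtain ⟨lam, hlam⟩ := Module.End.exists_eigenvalue ((R.π (single (p : ℤ) 1)).restrict hWp)
  obtain ⟨v, hv⟩ := hlam.exists_hasEigenvector
  have hv0 : (v : R.E) ≠ 0 := fun h => hv.2 (Subtype.ext h)
  have hvl : R.π (single (p : ℤ) 1) v = lam • (v : R.E) := congrArg Subtype.val hv.apply_eq_smul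
  have hlam0 : lam ≠ 0 := by
    rintro rfl
    exact hR.single_one_apply_ne_zero p hv0 (by rw [hvl, zero_smul])
  have hvl' : R.π (single (-(p : ℤ)) 1) v = lam⁻¹ • (v : R.E) := by
    have := hR.single_neg_apply p (v : R.E)
    rw [hvl, map_smul] at this
    rw [eq_inv_smul_iff₀ hlam0, this]
  -- Applied to `δᵖ` and to `δ⁻ᵖ`, this bounds both `lam` and its inverse by one.
  have hle {n : ℤ} {c : ℂ} (h : R.π (single n 1) (v : R.E) = c • (v : R.E)) : ‖c‖ ≤ 1 :=
    (hR.norm_eigenvalue_le hv0 h).trans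
      (mul_le_one₀ (norm_single_one_le n) (norm_nonneg _) (norm_single_one_le 0))
  have hnorm : ‖lam‖ = 1 := by
    refine le_antisymm (hle hvl) ?_
    have := hle hvl'
    rwa [norm_inv, inv_le_one₀ (norm_pos_iff.2 hlam0)] at this
  exact ⟨⟨x, hper⟩, ⟨lam, mem_sphere_zero_iff_norm.2 hnorm⟩, v, hv0, (hW _).1 v.2, hvl⟩

end FDRep

end Weight

/-! ### The model representations in coordinates -/

section PointRep

variable {X : Type u} [TopologicalSpace X] [CompactSpace X] {σ : X ≃ₜ X}

open EllOne

/-- The basis vector `e_j` of the representation space of `π_{x,λ}`. -/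
def pointVec (x : Per σ) (lam : Circle) (j : Fin (Function.minimalPeriod σ x.1)) :
    (pointRep.{u, w} x lam).E :=
  EuclideanSpace.single (⟨j⟩ : Idx.{w} (Function.minimalPeriod σ x.1)) (1 : ℂ)

/-- The coordinates of a vector in the representation space of `π_{x,λ}`. -/
def pointCoord {x : Per σ} {lam : Circle} (v : (pointRep.{u, w} x lam).E)
    (j : Fin (Function.minimalPeriod σ x.1)) : ℂ :=
  (show PointSpace.{u, w} σ x.1 from v) ⟨j⟩

variable (x : Per σ) (lam : Circle)

theorem pointRep_fun_coord (f : C(X, ℂ)) (v : (pointRep.{u, w} x lam).E)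
    (j : Fin (Function.minimalPeriod σ x.1)) :
    pointCoord ((pointRep.{u, w} x lam).π (single 0 f) v) j =
      f ((⇑σ)^[(j : ℕ)] x.1) * pointCoord v j := by
  have h : pointStarRep.{u, w} σ x.1 lam (single 0 f) =
      Matrix.toEuclideanCLM (n := Idx.{w} (Function.minimalPeriod σ x.1)) (𝕜 := ℂ)
        (diagHom.{u, w} σ x.1 (Function.minimalPeriod σ x.1) f) :=
    (pointPair.{u, w} σ x.1 lam).toStarAlgHom_single_zero f
  have key (v : PointSpace.{u, w} σ x.1) : (pointStarRep.{u, w} σ x.1 lam (single 0 f) v) ⟨j⟩ =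
      f ((⇑σ)^[(j : ℕ)] x.1) * v ⟨j⟩ := by
    rw [h, Matrix.ofLp_toEuclideanCLM, diagHom_apply, Matrix.mulVec_diagonal]
  exact key v

theorem pointRep_shift_vec (j : Fin (Function.minimalPeriod σ x.1)) :
    (pointRep.{u, w} x lam).π (single 1 1) (pointVec x lam j) =
      if h : (j : ℕ) + 1 < Function.minimalPeriod σ x.1 then pointVec x lam ⟨j + 1, h⟩
      else (lam : ℂ) • pointVec x lam ⟨0, j.pos⟩ := by
  have h : pointStarRep.{u, w} σ x.1 lam (single 1 1) =
      Matrix.toEuclideanCLM (n := Idx.{w} (Function.minimalPeriod σ x.1)) (𝕜 := ℂ)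
        (shiftMatrix.{w} (Function.minimalPeriod σ x.1) lam) :=
    (pointPair.{u, w} σ x.1 lam).toStarAlgHom_delta
  change (pointStarRep.{u, w} σ x.1 lam (single 1 1)
    (EuclideanSpace.single (⟨j⟩ : Idx.{w} (Function.minimalPeriod σ x.1)) (1 : ℂ)) :
      PointSpace.{u, w} σ x.1) = _
  rw [h]
  have hj := j.2
  split_ifs with hlt
  · change _ = (EuclideanSpace.single _ (1 : ℂ) : PointSpace.{u, w} σ x.1)
    ext i
    rw [Matrix.ofLp_toEuclideanCLM]
    simp [shiftMatrix, hlt.ne, ULift.ext_iff, Fin.ext_iff]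
  · change _ = (lam : ℂ) • (EuclideanSpace.single _ (1 : ℂ) : PointSpace.{u, w} σ x.1)
    ext i
    rw [Matrix.ofLp_toEuclideanCLM]
    have : (j : ℕ) + 1 = Function.minimalPeriod σ x.1 := by omega
    simp [shiftMatrix, this, ULift.ext_iff, Fin.ext_iff]

end PointRep

theorem Per.minimalPeriod_pos {X : Type u} [TopologicalSpace X] {σ : X ≃ₜ X} (x : Per σ) :
    0 < Function.minimalPeriod σ x.1 :=
  Function.minimalPeriod_pos_of_mem_periodicPts x.2

section PointRep

variable {X : Type u} [TopologicalSpace X] [CompactSpace X] {σ : X ≃ₜ X}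

open EllOne

/-- The standard basis of the representation space of `π_{x,λ}`. -/
def pointBasis (x : Per σ) (lam : Circle) :
    Module.Basis (Fin (Function.minimalPeriod σ x.1)) ℂ (pointRep.{u, w} x lam).E :=
  show Module.Basis (Fin (Function.minimalPeriod σ x.1)) ℂ (PointSpace.{u, w} σ x.1) from
  (EuclideanSpace.basisFun (Idx.{w} (Function.minimalPeriod σ x.1)) ℂ).toBasis.reindex Equiv.ulift

variable (x : Per σ) (lam : Circle)

theorem pointBasis_apply (j : Fin (Function.minimalPeriod σ x.1)) :
    pointBasis.{u, w} x lam j = pointVec x lam j := by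
  have : ((EuclideanSpace.basisFun (Idx.{w} (Function.minimalPeriod σ x.1)) ℂ).toBasis.reindex
      Equiv.ulift) j = EuclideanSpace.single (⟨j⟩ : Idx.{w} (Function.minimalPeriod σ x.1))
        (1 : ℂ) := by
    rw [Module.Basis.reindex_apply, OrthonormalBasis.coe_toBasis, EuclideanSpace.basisFun_apply]
    rfl
  exact this

theorem pointBasis_repr (v : (pointRep.{u, w} x lam).E)
    (j : Fin (Function.minimalPeriod σ x.1)) :
    (pointBasis.{u, w} x lam).repr v j = pointCoord v j := by
  have (v : PointSpace.{u, w} σ x.1) :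
      ((EuclideanSpace.basisFun (Idx.{w} (Function.minimalPeriod σ x.1)) ℂ).toBasis.reindex
      Equiv.ulift).repr v j = v ⟨j⟩ := by
    rw [Module.Basis.repr_reindex_apply, OrthonormalBasis.coe_toBasis_repr_apply,
      EuclideanSpace.basisFun_repr]
    rfl
  exact this v

theorem pointRep_one (v : (pointRep.{u, w} x lam).E) : (pointRep.{u, w} x lam).π 1 v = v := by
  have h : pointStarRep.{u, w} σ x.1 lam 1 = 1 := map_one _
  change (pointStarRep.{u, w} σ x.1 lam 1 : PointSpace.{u, w} σ x.1 →L[ℂ] _) v = v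
  rw [h]
  rfl

theorem pointRep_fun_basis (f : C(X, ℂ)) (j : Fin (Function.minimalPeriod σ x.1)) :
    (pointRep.{u, w} x lam).π (single 0 f) (pointBasis x lam j) =
      f ((⇑σ)^[(j : ℕ)] x.1) • pointBasis x lam j := by
  refine (pointBasis x lam).repr.injective (Finsupp.ext fun i => ?_)
  rw [pointBasis_repr, pointRep_fun_coord, ← pointBasis_repr, map_smul, Finsupp.smul_apply,
    Module.Basis.repr_self, smul_eq_mul]
  by_cases h : j = i
  · rw [h]
  · rw [Finsupp.single_eq_of_ne' h, mul_zero, mul_zero]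

theorem pointRep_shift_basis {j : ℕ} (hj : j + 1 < Function.minimalPeriod σ x.1) :
    (pointRep.{u, w} x lam).π (single 1 1) (pointBasis x lam ⟨j, by omega⟩) =
      pointBasis x lam ⟨j + 1, hj⟩ := by
  rw [pointBasis_apply, pointRep_shift_vec, dif_pos hj, pointBasis_apply]

theorem pointRep_shift_basis_last {j : ℕ} (hj : j + 1 = Function.minimalPeriod σ x.1) :
    (pointRep.{u, w} x lam).π (single 1 1) (pointBasis x lam ⟨j, by omega⟩) =
      (lam : ℂ) • pointBasis x lam ⟨0, by omega⟩ := by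
  rw [pointBasis_apply, pointRep_shift_vec, dif_neg (by simp [hj]), pointBasis_apply]

theorem pointRep_single_basis_zero {j : ℕ} (hj : j < Function.minimalPeriod σ x.1) :
    (pointRep.{u, w} x lam).π (single (j : ℤ) 1) (pointBasis x lam ⟨0, x.minimalPeriod_pos⟩) =
      pointBasis x lam ⟨j, hj⟩ := by
  induction j with
  | zero => exact pointRep_one x lam _
  | succ j ih =>
    rw [← pointRep_shift_basis x lam hj, ← ih (by omega), FDRep.single_one_apply, add_comm]
    push_cast
    rfl

/-- Going once around the cycle multiplies `e_0` by `lam`. Every `e_j` is `δʲ e_0`, and `δᵖ`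
commutes with `δʲ`, so the same scalar acts everywhere. This makes `lam` an invariant of the
representation. -/
theorem pointRep_single_minimalPeriod (v : (pointRep.{u, w} x lam).E) :
    (pointRep.{u, w} x lam).π (single (Function.minimalPeriod σ x.1 : ℤ) 1) v = (lam : ℂ) • v := by
  have hpos := x.minimalPeriod_pos
  have h0 : (pointRep.{u, w} x lam).π (single (Function.minimalPeriod σ x.1 : ℤ) 1)
      (pointBasis x lam ⟨0, hpos⟩) = (lam : ℂ) • pointBasis x lam ⟨0, hpos⟩ := by
    rw [← pointRep_shift_basis_last x lam (j := Function.minimalPeriod σ x.1 - 1) (by omega),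
      ← pointRep_single_basis_zero x lam (j := Function.minimalPeriod σ x.1 - 1) (by omega),
      FDRep.single_one_apply]
    congr 3
    omega
  have h : (pointRep.{u, w} x lam).π (single (Function.minimalPeriod σ x.1 : ℤ) 1) =
      (lam : ℂ) • LinearMap.id := by
    refine (pointBasis x lam).ext fun j => ?_
    rw [← pointRep_single_basis_zero x lam j.2, FDRep.single_one_apply, add_comm,
      ← FDRep.single_one_apply, h0, map_smul]
    rfl
  rw [h]
  rfl

theorem pointRep_inner (a : EllOne σ) (v v' : PointSpace.{u, w} σ x.1) :
    inner ℂ (pointStarRep.{u, w} σ x.1 lam a v) v' =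
      inner ℂ v (pointStarRep.{u, w} σ x.1 lam (star a) v') := by
  rw [map_star, ContinuousLinearMap.star_eq_adjoint, ContinuousLinearMap.adjoint_inner_right]

/-! ### Irreducibility and classification -/

variable [T2Space X]

theorem pointRep_isAlgIrreducible : (pointRep.{u, w} x lam).IsAlgIrreducible := by
  have hpos := x.minimalPeriod_pos
  set b := pointBasis.{u, w} x lam with hb
  refine ⟨⟨1, b ⟨0, hpos⟩, by rw [pointRep_one]; exact b.ne_zero _⟩, fun W hW => ?_⟩
  refine or_iff_not_imp_left.2 fun hW0 => ?_
  obtain ⟨v, hvW, hv⟩ := (Submodule.ne_bot_iff W).1 hW0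
  obtain ⟨j, hj⟩ : ∃ j, b.repr v j ≠ 0 := by
    by_contra! h
    exact hv (b.repr.map_eq_zero_iff.1 (Finsupp.ext h))
  -- The iterates with exponents below the minimal period are distinct, so `f` can project `v` onto
  -- its nonzero `j`-th coordinate.
  obtain ⟨f, hf1, hf0⟩ := exists_eq_one_of_notMem (y := (⇑σ)^[(j : ℕ)] x.1)
    (s := (fun i : Fin (Function.minimalPeriod σ x.1) => (⇑σ)^[(i : ℕ)] x.1) '' {j}ᶜ)
    (Set.toFinite _) (by
      rintro ⟨i, hi, hij⟩
      exact hi (Fin.ext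
        ((Function.iterate_eq_iterate_iff_of_lt_minimalPeriod i.2 j.2).1 hij)))
  have hjW : b j ∈ W := by
    have h1 : (pointRep.{u, w} x lam).π (single 0 f) v = b.repr v j • b j := by
      refine b.repr.injective (Finsupp.ext fun i => ?_)
      rw [hb, pointBasis_repr, pointRep_fun_coord, ← pointBasis_repr, ← hb, map_smul,
        Finsupp.smul_apply, Module.Basis.repr_self, smul_eq_mul]
      by_cases h : j = i
      · rw [← h, hf1, Finsupp.single_eq_same, one_mul, mul_one]
      · rw [Finsupp.single_eq_of_ne' h, hf0 _ ⟨i, fun h' => h h'.symm, rfl⟩, mul_zero, zero_mul]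
    exact (W.smul_mem_iff hj).1 (h1 ▸ hW _ v hvW)
  -- The element `δ^(k - i)`, with possibly negative exponent, carries `e_i` to `e_k` without
  -- wrapping around, so no factor `lam` appears.
  have hshift {i k : ℕ} (hi : i < Function.minimalPeriod σ x.1)
      (hk : k < Function.minimalPeriod σ x.1) (h : b ⟨i, hi⟩ ∈ W) : b ⟨k, hk⟩ ∈ W := by
    have := hW (single ((k : ℤ) - i) 1) _ h
    rwa [hb, ← pointRep_single_basis_zero x lam hi, FDRep.single_one_apply, sub_add_cancel,
      pointRep_single_basis_zero x lam hk] at this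
  rw [eq_top_iff, ← b.span_eq, Submodule.span_le]
  rintro _ ⟨k, rfl⟩
  exact hshift j.2 k.2 hjW

/-- The map `e_j ↦ δʲ e` respects `C(X)` by the weight rule and `δ` by construction, hence all
monomials. Continuity extends this to the algebra, and Schur's lemma applies since `e_0` goes to `e
≠ 0`. -/
theorem FDRep.IsWeightVector.algEquivalent {x : Per σ} {lam : Circle}
    {R : FDRep.{u, w} (EllOne σ)} {e : R.E} (he : R.IsWeightVector x.1 lam e)
    (hR : R.IsAlgIrreducible) : (pointRep.{u, w} x lam).AlgEquivalent R := by
  have hS := pointRep_isAlgIrreducible.{u, w} x lam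
  set S := pointRep.{u, w} x lam
  set b := pointBasis.{u, w} x lam
  let T : S.E →ₗ[ℂ] R.E := b.constr ℂ fun j => R.π (single ((j : ℕ) : ℤ) 1) e
  have hTb (j : ℕ) (hj : j < Function.minimalPeriod σ x.1) :
      T (b ⟨j, hj⟩) = R.π (single (j : ℤ) 1) e := b.constr_basis ℂ _ _
  have hfun (f : C(X, ℂ)) (v : S.E) : T (S.π (single 0 f) v) = R.π (single 0 f) (T v) := by
    have : T ∘ₗ S.π (single 0 f) = R.π (single 0 f) ∘ₗ T := b.ext fun j => by
      rw [LinearMap.comp_apply, LinearMap.comp_apply, hTb j.1 j.2,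
        FDRep.apply_fun_single_one he.apply_fun, zpow_natCast_apply,
        show S.π (single 0 f) (b j) = _ from pointRep_fun_basis x lam f j, map_smul,
        hTb j.1 j.2]
    exact LinearMap.congr_fun this v
  have hone (v : S.E) : T (S.π (single 1 1) v) = R.π (single 1 1) (T v) := by
    have : T ∘ₗ S.π (single 1 1) = R.π (single 1 1) ∘ₗ T := b.ext fun j => by
      rw [LinearMap.comp_apply, LinearMap.comp_apply, hTb j.1 j.2, FDRep.single_one_apply]
      obtain ⟨j, hj⟩ := j
      by_cases h : j + 1 < Function.minimalPeriod σ x.1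
      · rw [show S.π (single 1 1) (b ⟨j, hj⟩) = _ from pointRep_shift_basis x lam h, hTb, add_comm]
        push_cast
        rfl
      -- Only at the last index is the eigenvalue equation `δᵖ e = lam e` needed.
      · have h' : j + 1 = Function.minimalPeriod σ x.1 := by omega
        rw [show S.π (single 1 1) (b ⟨j, hj⟩) = _ from pointRep_shift_basis_last x lam h',
          map_smul, hTb, show (1 : ℤ) + (j : ℕ) = (Function.minimalPeriod σ x.1 : ℤ) by omega, he.apply_shift]
        congr 1
        exact hR.map_one e
    exact LinearMap.congr_fun this v
  have hneg (v : S.E) : T (S.π (single (-1) 1) v) = R.π (single (-1) 1) (T v) := by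
    have h1 : S.π (single 1 1) (S.π (single (-1) 1) v) = v := by
      rw [FDRep.single_one_apply]
      exact hS.map_one v
    conv_rhs => rw [← h1, hone, FDRep.single_one_apply]
    exact (hR.map_one _).symm
  have hsingle (n : ℤ) (v : S.E) : T (S.π (single n 1) v) = R.π (single n 1) (T v) := by
    induction n generalizing v with
    | zero => exact hfun 1 v
    | succ n ih => rw [← FDRep.single_one_apply, ih, hone, FDRep.single_one_apply]
    | pred n ih =>
      rw [sub_eq_add_neg, ← FDRep.single_one_apply, ih, hneg, FDRep.single_one_apply]
  have hT (a : EllOne σ) (v : S.E) : T (S.π a v) = R.π a (T v) := by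
    -- The space `R.E` carries no topology, so the identity is tested against functionals; both
    -- sides become continuous scalar functions of `a`, compared on monomials.
    rw [← sub_eq_zero, ← Module.forall_dual_apply_eq_zero_iff ℂ]
    intro φ
    rw [map_sub, sub_eq_zero]
    let F : EllOne σ →+ ℂ := AddMonoidHom.mk' (fun a => φ (T (S.π a v))) fun a b => by
      rw [map_add, LinearMap.add_apply, map_add, map_add]
    let G : EllOne σ →+ ℂ := AddMonoidHom.mk' (fun a => φ (R.π a (T v))) fun a b => by
      rw [map_add, LinearMap.add_apply, map_add]
    refine ext_single (f := F) (g := G) (hS.continuous_apply (φ ∘ₗ T) v)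
      (hR.continuous_apply φ (T v)) (fun n c => congrArg φ ?_) a
    rw [single_eq_mul, map_mul, Module.End.mul_apply, hfun, hsingle, map_mul, Module.End.mul_apply]
  have hbij := hS.bijective_of_intertwining hR T hT (e := b ⟨0, x.minimalPeriod_pos⟩) (by
    rw [hTb]
    exact (hR.map_one e).trans_ne he.ne_zero)
  exact ⟨LinearEquiv.ofBijective T hbij, hT⟩

theorem FDRep.IsAlgIrreducible.exists_pointRep_algEquivalent {R : FDRep.{u, w} (EllOne σ)}
    (hR : R.IsAlgIrreducible) :
    ∃ (x : Per σ) (lam : Circle), (pointRep.{u, w} x lam).AlgEquivalent R := by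
  obtain ⟨x, lam, e, he⟩ := hR.exists_isWeightVector
  exact ⟨x, lam, he.algEquivalent hR⟩

/-- If `y = σⁿ x`, then `δⁿ e_0` in the representation of `x` is a weight vector for `y` with the
same `lam`, as periods agree along an orbit. -/
theorem pointRep_algEquivalent_of_orbit_eq {x y : Per σ} (h : orbit x = orbit y) (lam : Circle) :
    (pointRep.{u, w} y lam).AlgEquivalent (pointRep.{u, w} x lam) := by
  obtain ⟨n, hn⟩ : ∃ n : ℤ, (σ ^ n : X ≃ₜ X) x.1 = y.1 := Quotient.exact h
  obtain ⟨k, hk⟩ := exists_iterate_eq_zpow x.2 n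
  have hirr := pointRep_isAlgIrreducible.{u, w} x lam
  have hper : Function.minimalPeriod σ y.1 = Function.minimalPeriod σ x.1 := by
    rw [← hn, ← hk, Function.minimalPeriod_apply_iterate x.2]
  have hw (f : C(X, ℂ)) : (pointRep.{u, w} x lam).π (single 0 f)
      (pointBasis x lam ⟨0, x.minimalPeriod_pos⟩) =
      f x.1 • pointBasis x lam ⟨0, x.minimalPeriod_pos⟩ := pointRep_fun_basis x lam f _
  refine FDRep.IsWeightVector.algEquivalent (e := (pointRep.{u, w} x lam).π (single n 1)
    (pointBasis x lam ⟨0, x.minimalPeriod_pos⟩)) ⟨?_, fun f => ?_, ?_⟩ hirr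
  · exact hirr.single_one_apply_ne_zero n (Module.Basis.ne_zero _ _)
  · rw [FDRep.apply_fun_single_one hw, hn]
  · rw [hper, pointRep_single_minimalPeriod]

theorem orbit_eq_and_eq_of_algEquivalent {x y : Per σ} {lam mu : Circle}
    (h : (pointRep.{u, w} x lam).AlgEquivalent (pointRep.{u, w} y mu)) :
    orbit x = orbit y ∧ lam = mu := by
  obtain ⟨T, hT⟩ := h
  set e := pointBasis.{u, w} x lam ⟨0, x.minimalPeriod_pos⟩ with he
  have he0 : T e ≠ 0 := by
    rw [Ne, T.map_eq_zero_iff]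
    exact Module.Basis.ne_zero _ _
  obtain ⟨j, hj⟩ : ∃ j, (pointBasis y mu).repr (T e) j ≠ 0 := by
    by_contra! h
    exact he0 ((pointBasis y mu).repr.map_eq_zero_iff.1 (Finsupp.ext h))
  -- The vector `T e` has weight `x`, while its nonzero `j`-th coordinate is scaled by `f (σʲ y)`.
  -- Hence the two evaluations coincide.
  have hxy : (⇑σ)^[(j : ℕ)] y.1 = x.1 := eq_of_forall_apply_eq fun f => by
    have h1 := hT (single 0 f) e
    rw [he, pointRep_fun_basis, ← he, map_smul] at h1
    have h2 := congrArg (fun v => (pointBasis y mu).repr v j) h1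
    simp only [map_smul, Finsupp.smul_apply, smul_eq_mul] at h2
    rw [pointBasis_repr (v := (pointRep y mu).π _ _), pointRep_fun_coord, ← pointBasis_repr] at h2
    exact (mul_right_cancel₀ hj h2).symm
  refine ⟨Quotient.sound ((orbitSetoid σ).symm ⟨(j : ℕ), by rw [zpow_natCast_apply, hxy]⟩), ?_⟩
  -- The periods being equal, the same power of `δ` acts as `lam` on one side and as `mu` on the
  -- other.
  have h1 := hT (single (Function.minimalPeriod σ x.1 : ℤ) 1) e
  rw [pointRep_single_minimalPeriod, map_smul, ← hxy, Function.minimalPeriod_apply_iterate y.2,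
    pointRep_single_minimalPeriod] at h1
  exact Circle.ext (smul_left_injective ℂ he0 h1)

end PointRep

/-! ### Unitarizability and selfadjoint kernels -/

theorem FDRep.IsUnitarizable.isSelfadjointIdeal {A : Type v} [Ring A] [Algebra ℂ A] [StarRing A]
    {R : FDRep.{v, w} A} (h : R.IsUnitarizable) : IsSelfadjointIdeal R.kerIdeal := by
  obtain ⟨c, -, hc⟩ := h
  have key {a : A} (ha : a ∈ R.kerIdeal) : star a ∈ R.kerIdeal := by
    rw [FDRep.kerIdeal, TwoSidedIdeal.mem_ker] at ha ⊢
    ext e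
    -- If `π(a) = 0`, then `⟪π(a*)e, π(a*)e⟫ = ⟪e, π(a)π(a*)e⟫ = 0`.
    refine c.definite _ ?_
    have h0 := c.smul_left 0 e 0
    rw [zero_smul, map_zero, zero_mul] at h0
    rw [hc, star_star, ha, LinearMap.zero_apply, ← c.conj_inner_symm, h0, map_zero]
  refine Set.Subset.antisymm ?_ fun a ha => ⟨star a, key ha, star_star a⟩
  rintro _ ⟨a, ha, rfl⟩
  exact key ha

section Unitarizable

variable {X : Type u} [TopologicalSpace X] [CompactSpace X] [T2Space X] {σ : X ≃ₜ X}

theorem FDRep.IsAlgIrreducible.isUnitarizable {R : FDRep.{u, w} (EllOne σ)}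
    (hR : R.IsAlgIrreducible) : R.IsUnitarizable := by
  obtain ⟨x, lam, hxl⟩ := hR.exists_pointRep_algEquivalent
  obtain ⟨T, hT⟩ := (FDRep.setoid (EllOne σ)).symm hxl
  let T' : R.E ≃ₗ[ℂ] PointSpace.{u, w} σ x.1 := T
  have hT' (a : EllOne σ) (e : R.E) : T' (R.π a e) = pointStarRep.{u, w} σ x.1 lam a (T' e) :=
    hT a e
  -- The inner product of the model space is pulled back along the intertwiner.
  let c : InnerProductSpace.Core ℂ R.E :=
    { inner := fun e e' => inner ℂ (T' e) (T' e')
      conj_inner_symm := fun e e' => inner_conj_symm _ _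
      re_inner_nonneg := fun e => inner_self_nonneg
      add_left := fun e e' e'' => by rw [map_add, inner_add_left]
      smul_left := fun e e' r => by rw [map_smul, inner_smul_left]
      definite := fun e he => T'.map_eq_zero_iff.1 (inner_self_eq_zero.1 he) }
  refine ⟨c, ?_, fun a e e' => ?_⟩
  · let : NormedAddCommGroup R.E := c.toNormedAddCommGroup
    let : NormedSpace ℂ R.E := InnerProductSpace.Core.toNormedSpace
    exact FiniteDimensional.complete ℂ R.E
  · change inner ℂ (T' _) (T' _) = inner ℂ (T' _) (T' _)
    rw [hT', hT', pointRep_inner]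

end Unitarizable

end DynSys

end

theorem mainTheorem1 {X : Type u} [TopologicalSpace X] [CompactSpace X] [T2Space X] [Nonempty X]
    (σ : X ≃ₜ X) :
    ((∃ R : DynSys.FDRep.{u, w} (DynSys.EllOne σ), R.IsAlgIrreducible) ↔
      (Function.periodicPts σ).Nonempty) ∧
    (∃ Ξ : DynSys.FiniteOrbits σ × Circle → DynSys.FDRep.IrrClass.{u, w} (DynSys.EllOne σ),
      (∀ (x : DynSys.Per σ) (lam : Circle),
        (Ξ (DynSys.orbit x, lam)).1 = (DynSys.pointRep.{u, w} x lam).toClass) ∧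
      Function.Bijective Ξ) ∧
    (∀ R : DynSys.FDRep.{u, w} (DynSys.EllOne σ), R.IsAlgIrreducible →
      R.IsUnitarizable ∧ DynSys.IsSelfadjointIdeal R.kerIdeal) := by
  refine ⟨⟨?_, ?_⟩, ⟨fun q => ⟨Quotient.lift
      (fun x : DynSys.Per σ => (DynSys.pointRep.{u, w} x q.2).toClass)
      (fun x y hxy => Quotient.sound ((DynSys.FDRep.setoid _).symm
        (DynSys.pointRep_algEquivalent_of_orbit_eq (Quotient.sound hxy) q.2))) q.1, ?_⟩,
      fun _ _ => rfl, ?_, ?_⟩,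
    fun R hR => ⟨hR.isUnitarizable, hR.isUnitarizable.isSelfadjointIdeal⟩⟩
  · rintro ⟨R, hR⟩
    obtain ⟨x, -⟩ := hR.exists_pointRep_algEquivalent
    exact ⟨x.1, x.2⟩
  · rintro ⟨x, hx⟩
    exact ⟨_, DynSys.pointRep_isAlgIrreducible.{u, w} ⟨x, hx⟩ 1⟩
  · obtain ⟨o, lam⟩ := q
    induction o using Quotient.inductionOn with
    | h x => exact ⟨_, DynSys.pointRep_isAlgIrreducible x lam, rfl⟩
  · rintro ⟨o, lam⟩ ⟨o', mu⟩ h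
    induction o using Quotient.inductionOn with
    | h x =>
      induction o' using Quotient.inductionOn with
      | h y =>
        obtain ⟨h1, h2⟩ := DynSys.orbit_eq_and_eq_of_algEquivalent
          (Quotient.exact (congrArg Subtype.val h))
        exact Prod.ext h1 h2
  · rintro ⟨_, R, hR, rfl⟩
    obtain ⟨x, lam, h⟩ := hR.exists_pointRep_algEquivalent
    exact ⟨(DynSys.orbit x, lam), Subtype.ext (Quotient.sound h)⟩
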